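/- Let $I=[0,\pi]$ and let $L^2(I,\mathbb C^2)$ carry the scalar product $\langle f,g\rangle=\frac1\pi\int_0^\pi (f_1\overline{g_1}+f_2\overline{g_2})\,dx$. For $v=\begin{pmatrix}0&P\\Q&0\end{pmatrix}$ with $P,Q\in L^2(I)$, and a boundary condition $bc$ $$a_1y_1(0)+b_1y_1(\pi)+a_2y_2(0)+b_2y_2(\pi)=0,\qquad c_1y_1(0)+d_1y_1(\pi)+c_2y_2(0)+d_2y_2(\pi)=0,$$ let $L_{bc}(v)y=i\begin{pmatrix}1&0\\0&-1\end{pmatrix}y'+vy$ be the Dirac operator in $L^2(I,\mathbb C^2)$ whose domain consists of the absolutely continuous $y=(y_1,y_2)$ with $y'\in L^2$ that satisfy $bc$. Let $A_{ij}$ be the $2\times2$ matrix formed by the $i$-th and $j$-th columns of $\begin{pmatrix}a_1&b_1&a_2&b_2\\c_1&d_1&c_2&d_2\end{pmatrix}$ and $|A_{ij}|$ its determinant. Assume that $bc$ is strictly regular, that is, $|A_{14}|\ne0$, $|A_{23}|\neq0$ and $(|A_{13}|+|A_{24}|)^2\ne4|A_{14}||A_{23}|$. Let $z_1\ne z_2$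 be the roots of $|A_{14}|z^2+(|A_{13}|+|A_{24}|)z+|A_{23}|=0$; then $-z_1,-z_2$ are the eigenvalues of $A_{14}^{-1}A_{23}$, and we fix corresponding eigenvectors $(\alpha_1,\alpha_2)^T$, $(\beta_1,\beta_2)^T$ and put $\begin{pmatrix}\alpha_1'&\alpha_2'\\\beta_1'&\beta_2'\end{pmatrix}=\begin{pmatrix}\alpha_1&\beta_1\\\alpha_2&\beta_2\end{pmatrix}^{-1}$. Choose $\tau_1,\tau_2\in\mathbb C$ with $z_\mu=e^{i\pi\tau_\mu}$, $|\mathrm{Re}\,\tau_1-\mathrm{Re}\,\tau_2|\le1$, $|\mathrm{Re}\,\tau_1|\le1$. For $k\in2\mathbb Z$ let $$\varphi^1_k=\begin{pmatrix}\alpha_1e^{i\tau_1(\pi-x)}e^{-ikx}\\\alpha_2e^{i\tau_1x}e^{ikx}\end{pmatrix},\quad \varphi^2_k=\begin{pmatrix}\beta_1e^{i\tau_2(\pi-x)}e^{-ikx}\\\beta_2e^{i\tau_2x}e^{ikx}\end{pmatrix},\quad \tilde\varphi^1_k=\begin{pmatrix}\overline{\alpha_1'}e^{i\overline{\tau_1}(\pi-x)}e^{-ikx}\\\overline{\alpha_2'}e^{i\overline{\tau_1}x}e^{ikx}\end{pmatrix},\quad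 \tilde\varphi^2_k=\begin{pmatrix}\overline{\beta_1'}e^{i\overline{\tau_2}(\pi-x)}e^{-ikx}\\\overline{\beta_2'}e^{i\overline{\tau_2}x}e^{ikx}\end{pmatrix}.$$ The numbers $\langle v\varphi^\nu_k,\tilde\varphi^\mu_j\rangle=:w^{\mu\nu}(j+k)$ depend only on $j+k$; let $r(m)=\max_{\mu,\nu}|w^{\mu\nu}(m)|$ for $m\in2\mathbb Z$, and $\|r\|^2=\sum_{m\in2\mathbb Z}r(m)^2$. Let $A$ be the isomorphism of $L^2(I,\mathbb C^2)$ that maps $(e^{ikx},0)$ to $\varphi^1_k$ and $(0,e^{ikx})$ to $\varphi^2_k$ for $k\in2\mathbb Z$. Put $$T=\max\bigl(1,\;2\max(|\mathrm{Im}\,\tau_1|,\,|\mathrm{Im}\,\tau_2|,\,384\,\|A\|\,\|A^{-1}\|\,\|r\|^2)\bigr),\qquad \rho=\min\bigl(1-\tfrac12|\mathrm{Re}(\tau_1-\tau_2)|,\ \tfrac12|\tau_1-\tau_2|\bigr),$$ $$R_{NT}=\Bigl\{x+it:\ \bigl|x-\mathrm{Re}\,\tfrac{\tau_1+\tau_2}2\bigr|<N+1,\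 |t|<T\Bigr\},\qquad D^\mu_m=\{z\in\mathbb C:\ |z-\tau_\mu-m|<\rho\}.$$ Then there is an even positive integer $N=N(v,bc)$ such that, for every $\zeta\in\mathbb C$ with $|\zeta|\le1$, $$\mathrm{Sp}\,L_{bc}(\zeta v)\ \subset\ R_{NT}\ \cup\bigcup_{m\in2\mathbb Z,\ |m|>N}\bigl(D^1_m\cup D^2_m\bigr),$$ where $N$ does not depend on the choice of $\tau_1,\tau_2$ and of the eigenvectors. -/

import Mathlib

open MeasureTheory Set

noncomputable section

namespace DiracBVP

/-! ### The Hilbert space `L²([0,π], ℂ²)` -/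

/-- Normalized Lebesgue measure `dx / π` on the interval `[0, π]`. -/
def intervalMeasure : Measure ℝ :=
  (ENNReal.ofReal Real.pi)⁻¹ • volume.restrict (Icc 0 Real.pi)

/-- `L²([0,π])` with the norm `‖f‖² = (1/π) ∫₀^π |f|²`. -/
abbrev L2 : Type := Lp ℂ 2 intervalMeasure

/-- `L²([0,π], ℂ²)`, the Hilbert sum of two copies of `L²([0,π])`. -/
abbrev H : Type := PiLp 2 (fun _ : Fin 2 => L2)

theorem ae_intervalMeasure_iff {p : ℝ → Prop} :
    (∀ᵐ x ∂intervalMeasure, p x) ↔ ∀ᵐ x ∂(volume.restrict (Icc 0 Real.pi)), p x := by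
  have h : (ENNReal.ofReal Real.pi)⁻¹ ≠ 0 := by simp
  rw [intervalMeasure, Measure.ae_ennreal_smul_measure_iff h]

/-! ### Boundary conditions -/

/-- The `2 × 2` matrix formed by the columns `i` and `j` of a `2 × 4` matrix (columns are numbered
from `0`). -/
def minor (M : Matrix (Fin 2) (Fin 4) ℂ) (i j : Fin 4) : Matrix (Fin 2) (Fin 2) ℂ :=
  M.submatrix id ![i, j]

/-- The boundary condition with matrix `M`, imposed on `y = (y₁, y₂)`: the vector
`(y₁(0), y₁(π), y₂(0), y₂(π))` is annihilated by `M`. -/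
def SatisfiesBC (M : Matrix (Fin 2) (Fin 4) ℂ) (y : Fin 2 → ℝ → ℂ) : Prop :=
  M.mulVec ![y 0 0, y 0 Real.pi, y 1 0, y 1 Real.pi] = 0

/-- Strict regularity: `|A₁₄| ≠ 0`, `|A₂₃| ≠ 0` and `(|A₁₃| + |A₂₄|)² ≠ 4 |A₁₄| |A₂₃|`. -/
structure StrictlyRegular (M : Matrix (Fin 2) (Fin 4) ℂ) : Prop where
  det14 : (minor M 0 3).det ≠ 0
  det23 : (minor M 1 2).det ≠ 0
  discr : ((minor M 0 2).det + (minor M 1 3).det) ^ 2 ≠ 4 * (minor M 0 3).det * (minor M 1 2).det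

/-- The matrix `A₁₄⁻¹ A₂₃`, which describes the boundary condition in its normal form. -/
def normalMatrix (M : Matrix (Fin 2) (Fin 4) ℂ) : Matrix (Fin 2) (Fin 2) ℂ :=
  (minor M 0 3)⁻¹ * minor M 1 2

/-! ### The Dirac operator -/

/-- `y` is absolutely continuous on `[0,π]` and its derivative `g` is in `L²`. -/
structure IsACWithDeriv (y g : ℝ → ℂ) : Prop where
  memLp : MemLp g 2 intervalMeasure
  eq_integral : ∀ x ∈ Icc 0 Real.pi, y x = y 0 + ∫ t in (0 : ℝ)..x, g t

/-- `u` is in the domain of the Dirac operator with potential `v = (0, P; Q, 0)`, subject to the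
boundary condition `M`, and the operator maps `u` to `w`. The domain consists of the absolutely
continuous functions with derivative in `L²` that satisfy the boundary condition, and the operator
is `y ↦ i (1, 0; 0, -1) y' + v y`. -/
def IsDiracPair (M : Matrix (Fin 2) (Fin 4) ℂ) (P Q : ℝ → ℂ) (u w : H) : Prop :=
  ∃ y g : Fin 2 → ℝ → ℂ, (∀ j, IsACWithDeriv (y j) (g j)) ∧ SatisfiesBC M y ∧
    (∀ j, ∀ᵐ x ∂intervalMeasure, u j x = y j x) ∧
    (∀ᵐ x ∂intervalMeasure, w 0 x = Complex.I * g 0 x + P x * y 1 x) ∧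
    (∀ᵐ x ∂intervalMeasure, w 1 x = -Complex.I * g 1 x + Q x * y 0 x)

theorem MemLp.intervalIntegrable_of_intervalMeasure {g : ℝ → ℂ}
    (hg : MemLp g 2 intervalMeasure) {x : ℝ} (hx : x ∈ Icc 0 Real.pi) :
    IntervalIntegrable g volume 0 x := by
  have hc : (ENNReal.ofReal Real.pi)⁻¹ ≠ 0 := by simp
  have hc' : (ENNReal.ofReal Real.pi)⁻¹ ≠ ⊤ := by simp [Real.pi_pos]
  have h1 : MemLp g 2 (volume.restrict (Icc 0 Real.pi)) := by
    have h2 := hg.smul_measure (c := ENNReal.ofReal Real.pi) ENNReal.ofReal_ne_top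
    rwa [intervalMeasure, smul_smul, ENNReal.mul_inv_cancel (by simp [Real.pi_pos])
      ENNReal.ofReal_ne_top, one_smul] at h2
  have h3 : IntegrableOn g (Icc 0 Real.pi) := h1.integrable (by norm_num)
  rw [intervalIntegrable_iff_integrableOn_Ioc_of_le hx.1]
  exact h3.mono_set fun t ht => ⟨ht.1.le, ht.2.trans hx.2⟩

/-- The graph of the Dirac operator `L_bc(v)`. -/
def diracGraph (M : Matrix (Fin 2) (Fin 4) ℂ) (P Q : ℝ → ℂ) : Submodule ℂ (H × H) where
  carrier := {p | IsDiracPair M P Q p.1 p.2}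
  add_mem' := by
    rintro ⟨u, w⟩ ⟨u', w'⟩ ⟨y, g, h1, h2, h3, h4, h5⟩ ⟨y', g', h1', h2', h3', h4', h5'⟩
    refine ⟨fun j x => y j x + y' j x, fun j x => g j x + g' j x, fun j => ⟨(h1 j).memLp.add
      (h1' j).memLp, fun x hx => ?_⟩, ?_, fun j => ?_, ?_, ?_⟩
    · rw [intervalIntegral.integral_add
        (MemLp.intervalIntegrable_of_intervalMeasure (h1 j).memLp hx)
        (MemLp.intervalIntegrable_of_intervalMeasure (h1' j).memLp hx)]
      linear_combination (h1 j).eq_integral x hx + (h1' j).eq_integral x hx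
    · unfold SatisfiesBC at *
      have := congrArg₂ (· + ·) h2 h2'
      simp only [← Matrix.mulVec_add, add_zero] at this
      simpa using this
    · filter_upwards [h3 j, h3' j, Lp.coeFn_add (u j) (u' j)] with x a b c
      simp only [Prod.mk_add_mk, PiLp.add_apply]
      rw [c, Pi.add_apply, a, b]
    · filter_upwards [h4, h4', Lp.coeFn_add (w 0) (w' 0)] with x a b c
      simp only [Prod.mk_add_mk, PiLp.add_apply]
      rw [c, Pi.add_apply, a, b]
      ring
    · filter_upwards [h5, h5', Lp.coeFn_add (w 1) (w' 1)] with x a b c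
      simp only [Prod.mk_add_mk, PiLp.add_apply]
      rw [c, Pi.add_apply, a, b]
      ring
  zero_mem' := by
    refine ⟨fun _ _ => 0, fun _ _ => 0, fun j => ⟨MemLp.zero, by simp⟩, ?_, fun j => ?_, ?_, ?_⟩
    · have h0 : (![0, 0, 0, 0] : Fin 4 → ℂ) = 0 := by ext i; fin_cases i <;> rfl
      simp [SatisfiesBC, h0]
    all_goals
      filter_upwards [Lp.coeFn_zero ℂ 2 intervalMeasure] with x a
      simpa using a
  smul_mem' := by
    rintro z ⟨u, w⟩ ⟨y, g, h1, h2, h3, h4, h5⟩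
    refine ⟨fun j x => z * y j x, fun j x => z * g j x, fun j => ⟨(h1 j).memLp.const_mul z,
      fun x hx => ?_⟩, ?_, fun j => ?_, ?_, ?_⟩
    · rw [intervalIntegral.integral_const_mul]
      linear_combination z * (h1 j).eq_integral x hx
    · unfold SatisfiesBC at *
      have := congrArg (z • ·) h2
      simp only [← Matrix.mulVec_smul, smul_zero] at this
      simpa using this
    · filter_upwards [h3 j, Lp.coeFn_smul z (u j)] with x a c
      simp only [Prod.smul_mk, PiLp.smul_apply]
      rw [c, Pi.smul_apply, a, smul_eq_mul]
    · filter_upwards [h4, Lp.coeFn_smul z (w 0)] with x a c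
      simp only [Prod.smul_mk, PiLp.smul_apply]
      rw [c, Pi.smul_apply, a, smul_eq_mul]
      ring
    · filter_upwards [h5, Lp.coeFn_smul z (w 1)] with x a c
      simp only [Prod.smul_mk, PiLp.smul_apply]
      rw [c, Pi.smul_apply, a, smul_eq_mul]
      ring

/-- An absolutely continuous function that vanishes almost everywhere vanishes together with its
derivative. -/
theorem IsACWithDeriv.eq_zero {y g : ℝ → ℂ} (h : IsACWithDeriv y g)
    (hy : ∀ᵐ x ∂intervalMeasure, y x = 0) :
    (∀ x ∈ Icc 0 Real.pi, y x = 0) ∧ ∀ᵐ x ∂intervalMeasure, g x = 0 := by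
  have hint : IntervalIntegrable g volume 0 Real.pi :=
    MemLp.intervalIntegrable_of_intervalMeasure h.memLp ⟨Real.pi_pos.le, le_rfl⟩
  have hcont : ContinuousOn y (Icc 0 Real.pi) := by
    have h1 : ContinuousOn (fun x => y 0 + ∫ t in (0 : ℝ)..x, g t) (Icc 0 Real.pi) := by
      have := intervalIntegral.continuousOn_primitive_interval' (μ := volume) hint
        (left_mem_uIcc)
      rw [uIcc_of_le Real.pi_pos.le] at this
      exact continuousOn_const.add this
    exact h1.congr h.eq_integral
  have hzero : EqOn y (fun _ => 0) (Icc 0 Real.pi) := by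
    rw [ae_intervalMeasure_iff] at hy
    refine Measure.eqOn_Icc_of_ae_eq volume Real.pi_pos.ne ?_ hcont continuousOn_const
    exact hy
  refine ⟨hzero, ?_⟩
  rw [ae_intervalMeasure_iff, ← restrict_Ioo_eq_restrict_Icc]
  have hG : ∀ x ∈ Icc 0 Real.pi, ∫ t in (0 : ℝ)..x, g t = 0 := by
    intro x hx
    have h1 := h.eq_integral x hx
    rw [hzero hx, hzero ⟨le_rfl, Real.pi_pos.le⟩] at h1
    simpa using h1.symm
  have hd := hint.ae_hasDerivAt_integral
  rw [ae_restrict_iff' measurableSet_Ioo]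
  filter_upwards [hd] with x hx hxI
  have h2 := hx (by rw [uIcc_of_le Real.pi_pos.le]; exact ⟨hxI.1.le, hxI.2.le⟩) 0
    (by rw [uIcc_of_le Real.pi_pos.le]; exact ⟨le_rfl, Real.pi_pos.le⟩)
  have h3 : HasDerivAt (fun b => ∫ t in (0 : ℝ)..b, g t) 0 x := by
    refine (hasDerivAt_const x (0 : ℂ)).congr_of_eventuallyEq ?_
    filter_upwards [Ioo_mem_nhds hxI.1 hxI.2] with t ht
    exact hG t ⟨ht.1.le, ht.2.le⟩
  exact h2.unique h3

theorem diracGraph_isGraph (M : Matrix (Fin 2) (Fin 4) ℂ) (P Q : ℝ → ℂ) :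
    ∀ p : H × H, p ∈ diracGraph M P Q → p.1 = 0 → p.2 = 0 := by
  rintro ⟨u, w⟩ ⟨y, g, h1, -, h3, h4, h5⟩ rfl
  have hy : ∀ j, ∀ᵐ x ∂intervalMeasure, y j x = 0 := fun j => by
    filter_upwards [h3 j, Lp.coeFn_zero ℂ 2 intervalMeasure] with x a b
    rw [← a]
    simpa using b
  have hg := fun j => ((h1 j).eq_zero (hy j)).2
  ext j : 1
  rw [PiLp.zero_apply, Lp.eq_zero_iff_ae_eq_zero]
  fin_cases j
  · filter_upwards [h4, hg 0, hy 1] with x a b c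
    simp [a, b, c]
  · filter_upwards [h5, hg 1, hy 0] with x a b c
    simp [a, b, c]

/-- The Dirac operator `L_bc(v)`, an unbounded operator in `L²([0,π], ℂ²)`. -/
def diracOperator (M : Matrix (Fin 2) (Fin 4) ℂ) (P Q : ℝ → ℂ) : H →ₗ.[ℂ] H :=
  (diracGraph M P Q).toLinearPMap

theorem mem_graph_diracOperator (M : Matrix (Fin 2) (Fin 4) ℂ) (P Q : ℝ → ℂ) (u w : H) :
    (u, w) ∈ (diracOperator M P Q).graph ↔ IsDiracPair M P Q u w := by
  rw [diracOperator, Submodule.toLinearPMap_graph_eq _ (diracGraph_isGraph M P Q)]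
  rfl

/-- The spectrum of an unbounded operator `L`: the set of all `z` such that `z - L` is not a
bijection of the domain of `L` onto the space with a bounded inverse `R`. -/
def unboundedSpectrum {E : Type*} [NormedAddCommGroup E] [NormedSpace ℂ E] (L : E →ₗ.[ℂ] E) :
    Set ℂ :=
  {z | ¬ ∃ R : E →L[ℂ] E, (∀ f : E, ∃ h : R f ∈ L.domain, z • R f - L ⟨R f, h⟩ = f) ∧
    ∀ u : L.domain, R (z • (u : E) - L u) = u}

/-! ### The eigenfunctions of the free operator -/

/-- Admissible choices of the exponents `τ = (τ₁, τ₂)` and of the matrix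
`W = (α₁, β₁; α₂, β₂)` of eigenvectors: `z_μ = exp(iπ τ_μ)`, `μ = 1, 2`, are the two distinct roots
of `|A₁₄| z² + (|A₁₃| + |A₂₄|) z + |A₂₃| = 0`, the `μ`-th column of `W` is an eigenvector of
`A₁₄⁻¹ A₂₃` for the eigenvalue `-z_μ`, and `|Re τ₁ - Re τ₂| ≤ 1`, `|Re τ₁| ≤ 1`. -/
structure IsFreeData (M : Matrix (Fin 2) (Fin 4) ℂ) (τ : Fin 2 → ℂ)
    (W : Matrix (Fin 2) (Fin 2) ℂ) : Prop where
  root : ∀ μ, (minor M 0 3).det * Complex.exp (Complex.I * Real.pi * τ μ) ^ 2 +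
    ((minor M 0 2).det + (minor M 1 3).det) * Complex.exp (Complex.I * Real.pi * τ μ) +
    (minor M 1 2).det = 0
  root_ne : Complex.exp (Complex.I * Real.pi * τ 0) ≠ Complex.exp (Complex.I * Real.pi * τ 1)
  re_sub_le : |(τ 0).re - (τ 1).re| ≤ 1
  re_le : |(τ 0).re| ≤ 1
  col_ne : ∀ μ, W.col μ ≠ 0
  eigen : ∀ μ, (normalMatrix M).mulVec (W.col μ) =
    -Complex.exp (Complex.I * Real.pi * τ μ) • W.col μ

/-- The eigenfunction `φ^μ_k` of the free operator (`k` even). -/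
def phi (τ : Fin 2 → ℂ) (W : Matrix (Fin 2) (Fin 2) ℂ) (μ : Fin 2) (k : ℤ) :
    Fin 2 → ℝ → ℂ :=
  ![fun x => W 0 μ * Complex.exp (Complex.I * τ μ * (Real.pi - x)) *
      Complex.exp (-Complex.I * k * x),
    fun x => W 1 μ * Complex.exp (Complex.I * τ μ * x) * Complex.exp (Complex.I * k * x)]

/-- The function `φ̃^μ_k` of the system biorthogonal to `(φ^μ_k)`. The rows of `W⁻¹` are
`(α₁', α₂')` and `(β₁', β₂')`. -/
def phiDual (τ : Fin 2 → ℂ) (W : Matrix (Fin 2) (Fin 2) ℂ) (μ : Fin 2) (k : ℤ) :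
    Fin 2 → ℝ → ℂ :=
  ![fun x => starRingEnd ℂ (W⁻¹ μ 0) *
      Complex.exp (Complex.I * starRingEnd ℂ (τ μ) * (Real.pi - x)) *
      Complex.exp (-Complex.I * k * x),
    fun x => starRingEnd ℂ (W⁻¹ μ 1) * Complex.exp (Complex.I * starRingEnd ℂ (τ μ) * x) *
      Complex.exp (Complex.I * k * x)]

/-- The matrix element `⟨V φ^ν_k, φ̃^μ_j⟩ = (1/π) ∫₀^π (P φ_2 conj(φ̃_1) + Q φ_1 conj(φ̃_2)) dx` of
the operator `V` of multiplication by the potential. -/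
def matrixElement (τ : Fin 2 → ℂ) (W : Matrix (Fin 2) (Fin 2) ℂ) (P Q : ℝ → ℂ) (μ ν : Fin 2)
    (j k : ℤ) : ℂ :=
  ∫ x, (P x * phi τ W ν k 1 x * starRingEnd ℂ (phiDual τ W μ j 0 x) +
    Q x * phi τ W ν k 0 x * starRingEnd ℂ (phiDual τ W μ j 1 x)) ∂intervalMeasure

/-- The matrix element depends on `j + k` only. -/
theorem matrixElement_eq (τ : Fin 2 → ℂ) (W : Matrix (Fin 2) (Fin 2) ℂ) (P Q : ℝ → ℂ)
    (μ ν : Fin 2) (j k : ℤ) :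
    matrixElement τ W P Q μ ν j k = matrixElement τ W P Q μ ν (j + k) 0 := by
  unfold matrixElement
  congr 1
  funext x
  have h1 : Complex.exp (Complex.I * k * x) * starRingEnd ℂ (Complex.exp (-Complex.I * j * x)) =
      starRingEnd ℂ (Complex.exp (-Complex.I * (j + k : ℤ) * x)) := by
    simp only [← Complex.exp_conj, ← Complex.exp_add]
    congr 1
    simp
    ring
  have h2 : Complex.exp (-Complex.I * k * x) * starRingEnd ℂ (Complex.exp (Complex.I * j * x)) =
      starRingEnd ℂ (Complex.exp (Complex.I * (j + k : ℤ) * x)) := by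
    simp only [← Complex.exp_conj, ← Complex.exp_add]
    congr 1
    simp
    ring
  simp only [phi, phiDual, Matrix.cons_val_zero, Matrix.cons_val_one, map_mul, ← h1, ← h2,
    Int.cast_zero, mul_zero, zero_mul, Complex.exp_zero, mul_one]
  ring

/-- `w^{μν}(m)`, the common value of `⟨V φ^ν_k, φ̃^μ_j⟩` for `j + k = m`. -/
def wCoeff (τ : Fin 2 → ℂ) (W : Matrix (Fin 2) (Fin 2) ℂ) (P Q : ℝ → ℂ) (μ ν : Fin 2) (m : ℤ) :
    ℂ :=
  matrixElement τ W P Q μ ν m 0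

/-- `r(m) = max {|w^{μν}(m)| : μ, ν = 1, 2}`. -/
def rCoeff (τ : Fin 2 → ℂ) (W : Matrix (Fin 2) (Fin 2) ℂ) (P Q : ℝ → ℂ) (m : ℤ) : ℝ :=
  max (max ‖wCoeff τ W P Q 0 0 m‖ ‖wCoeff τ W P Q 0 1 m‖)
    (max ‖wCoeff τ W P Q 1 0 m‖ ‖wCoeff τ W P Q 1 1 m‖)

/-- `‖r‖²`, the square of the norm of `r` in `ℓ²(2ℤ)`. -/
def rNormSq (τ : Fin 2 → ℂ) (W : Matrix (Fin 2) (Fin 2) ℂ) (P Q : ℝ → ℂ) : ℝ :=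
  ∑' n : ℤ, rCoeff τ W P Q (2 * n) ^ 2

/-! ### The isomorphism onto the basis of eigenfunctions -/

theorem memLp_exp (c : ℂ) :
    MemLp (fun x : ℝ => Complex.exp (Complex.I * c * x)) ⊤ intervalMeasure := by
  have hcont : Continuous fun x : ℝ => Complex.exp (Complex.I * c * x) := by fun_prop
  obtain ⟨B, hB⟩ := (isCompact_Icc (a := (0 : ℝ)) (b := Real.pi)).exists_bound_of_continuousOn
    hcont.continuousOn
  refine memLp_top_of_bound hcont.aestronglyMeasurable B ?_
  rw [ae_intervalMeasure_iff]
  exact (ae_restrict_iff' measurableSet_Icc).2 (Filter.Eventually.of_forall hB)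

/-- Multiplication by `exp(i c x)` on `L²([0,π])`. -/
def mulExp (c : ℂ) : L2 →L[ℂ] L2 :=
  (ContinuousLinearMap.mul ℂ ℂ).holderL intervalMeasure ⊤ 2 2 ((memLp_exp c).toLp _)

theorem mulExp_apply (c : ℂ) (f : L2) :
    ∀ᵐ x ∂intervalMeasure, mulExp c f x = Complex.exp (Complex.I * c * x) * f x := by
  filter_upwards [(ContinuousLinearMap.mul ℂ ℂ).coeFn_holder (r := 2) ((memLp_exp c).toLp _) f,
    (memLp_exp c).coeFn_toLp] with x a b
  rw [← b]
  exact a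

theorem measurePreserving_reflect :
    MeasurePreserving (fun x : ℝ => Real.pi - x) intervalMeasure intervalMeasure := by
  refine MeasurePreserving.smul_measure ?_ _
  have h := (Measure.measurePreserving_sub_left volume Real.pi).restrict_preimage
    (measurableSet_Icc (a := (0 : ℝ)) (b := Real.pi))
  simpa using h

/-- The reflection `f(x) ↦ f(π - x)` on `L²([0,π])`. -/
def reflect : L2 →L[ℂ] L2 :=
  (Lp.compMeasurePreservingₗᵢ ℂ (fun x : ℝ => Real.pi - x)
    measurePreserving_reflect).toContinuousLinearMap

theorem reflect_apply (f : L2) :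
    ∀ᵐ x ∂intervalMeasure, reflect f x = f (Real.pi - x) :=
  Lp.coeFn_compMeasurePreserving f measurePreserving_reflect

/-- The operator `A` that maps the orthonormal basis `e¹_k = (e^{ikx}, 0)`, `e²_k = (0, e^{ikx})`,
`k` even, to the system `(φ^μ_k)`: with `W = (α₁, β₁; α₂, β₂)`,
`A (f, g) (x) = (α₁ e^{iτ₁(π-x)} f(π-x) + β₁ e^{iτ₂(π-x)} g(π-x),
α₂ e^{iτ₁x} f(x) + β₂ e^{iτ₂x} g(x))`. -/
def basisMap (τ : Fin 2 → ℂ) (W : Matrix (Fin 2) (Fin 2) ℂ) : H →L[ℂ] H :=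
  (PiLp.continuousLinearEquiv 2 ℂ (fun _ : Fin 2 => L2)).symm.toContinuousLinearMap ∘L
    ContinuousLinearMap.pi
      ![∑ μ, W 0 μ • (reflect ∘L mulExp (τ μ) ∘L PiLp.proj 2 (fun _ : Fin 2 => L2) μ),
        ∑ μ, W 1 μ • (mulExp (τ μ) ∘L PiLp.proj 2 (fun _ : Fin 2 => L2) μ)]

theorem basisMap_apply_zero (τ : Fin 2 → ℂ) (W : Matrix (Fin 2) (Fin 2) ℂ) (F : H) :
    ∀ᵐ x ∂intervalMeasure, basisMap τ W F 0 x =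
      W 0 0 * Complex.exp (Complex.I * τ 0 * (Real.pi - x)) * F 0 (Real.pi - x) +
      W 0 1 * Complex.exp (Complex.I * τ 1 * (Real.pi - x)) * F 1 (Real.pi - x) := by
  have e : basisMap τ W F 0 = W 0 0 • reflect (mulExp (τ 0) (F 0)) +
      W 0 1 • reflect (mulExp (τ 1) (F 1)) := by
    simp [basisMap, Fin.sum_univ_two]
  have hq := measurePreserving_reflect.quasiMeasurePreserving
  rw [e]
  filter_upwards [Lp.coeFn_add (W 0 0 • reflect (mulExp (τ 0) (F 0)))
      (W 0 1 • reflect (mulExp (τ 1) (F 1))),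
    Lp.coeFn_smul (W 0 0) (reflect (mulExp (τ 0) (F 0))),
    Lp.coeFn_smul (W 0 1) (reflect (mulExp (τ 1) (F 1))),
    reflect_apply (mulExp (τ 0) (F 0)), reflect_apply (mulExp (τ 1) (F 1)),
    hq.ae (mulExp_apply (τ 0) (F 0)), hq.ae (mulExp_apply (τ 1) (F 1))] with x a b c d e f g
  rw [a, Pi.add_apply, b, c, Pi.smul_apply, Pi.smul_apply, d, e, f, g]
  simp [smul_eq_mul, mul_assoc]

theorem basisMap_apply_one (τ : Fin 2 → ℂ) (W : Matrix (Fin 2) (Fin 2) ℂ) (F : H) :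
    ∀ᵐ x ∂intervalMeasure, basisMap τ W F 1 x =
      W 1 0 * Complex.exp (Complex.I * τ 0 * x) * F 0 x +
      W 1 1 * Complex.exp (Complex.I * τ 1 * x) * F 1 x := by
  have e : basisMap τ W F 1 = W 1 0 • mulExp (τ 0) (F 0) + W 1 1 • mulExp (τ 1) (F 1) := by
    simp [basisMap, Fin.sum_univ_two]
  rw [e]
  filter_upwards [Lp.coeFn_add (W 1 0 • mulExp (τ 0) (F 0)) (W 1 1 • mulExp (τ 1) (F 1)),
    Lp.coeFn_smul (W 1 0) (mulExp (τ 0) (F 0)), Lp.coeFn_smul (W 1 1) (mulExp (τ 1) (F 1)),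
    mulExp_apply (τ 0) (F 0), mulExp_apply (τ 1) (F 1)] with x a b c d e
  rw [a, Pi.add_apply, b, c, Pi.smul_apply, Pi.smul_apply, d, e]
  simp [smul_eq_mul, mul_assoc]

theorem mulExp_neg_comp (c : ℂ) (f : L2) : mulExp (-c) (mulExp c f) = f := by
  refine Lp.ext ?_
  filter_upwards [mulExp_apply (-c) (mulExp c f), mulExp_apply c f] with x a b
  rw [a, b, ← mul_assoc, ← Complex.exp_add]
  simp

theorem reflect_reflect (f : L2) : reflect (reflect f) = f := by
  refine Lp.ext ?_
  filter_upwards [reflect_apply (reflect f),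
    measurePreserving_reflect.quasiMeasurePreserving.ae (reflect_apply f)] with x a b
  rw [a, b, sub_sub_cancel]

/-- The matrix of eigenvectors is invertible. -/
theorem IsFreeData.det_ne_zero {M : Matrix (Fin 2) (Fin 4) ℂ} {τ : Fin 2 → ℂ}
    {W : Matrix (Fin 2) (Fin 2) ℂ} (h : IsFreeData M τ W) : W.det ≠ 0 := by
  have hli : LinearIndependent ℂ W.col := by
    refine Module.End.eigenvectors_linearIndependent' (Matrix.toLin' (normalMatrix M))
      (fun μ => -Complex.exp (Complex.I * Real.pi * τ μ)) ?_ W.col fun μ => ?_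
    · intro a b hab
      have hab' := neg_injective hab
      fin_cases a <;> fin_cases b
      · rfl
      · exact absurd hab' h.root_ne
      · exact absurd hab'.symm h.root_ne
      · rfl
    · exact ⟨Module.End.mem_eigenspace_iff.2 (h.eigen μ), h.col_ne μ⟩
  exact ((Matrix.isUnit_iff_isUnit_det W).1
    (Matrix.linearIndependent_cols_iff_isUnit.1 hli)).ne_zero

/-- `A` is an isomorphism. -/
theorem basisMap_isInvertible (τ : Fin 2 → ℂ) {W : Matrix (Fin 2) (Fin 2) ℂ} (hW : W.det ≠ 0) :
    (basisMap τ W).IsInvertible := by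
  let B : H →L[ℂ] H :=
    (PiLp.continuousLinearEquiv 2 ℂ (fun _ : Fin 2 => L2)).symm.toContinuousLinearMap ∘L
      ContinuousLinearMap.pi fun μ =>
        mulExp (-τ μ) ∘L (W⁻¹ μ 0 • (reflect ∘L PiLp.proj 2 (fun _ : Fin 2 => L2) 0) +
          W⁻¹ μ 1 • PiLp.proj 2 (fun _ : Fin 2 => L2) 1)
  have hB : ∀ F μ, B F μ = mulExp (-τ μ) (W⁻¹ μ 0 • reflect (F 0) + W⁻¹ μ 1 • F 1) :=
    fun F μ => by simp [B]
  have hA0 : ∀ F, basisMap τ W F 0 = W 0 0 • reflect (mulExp (τ 0) (F 0)) +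
      W 0 1 • reflect (mulExp (τ 1) (F 1)) := fun F => by simp [basisMap, Fin.sum_univ_two]
  have hA1 : ∀ F, basisMap τ W F 1 = W 1 0 • mulExp (τ 0) (F 0) + W 1 1 • mulExp (τ 1) (F 1) :=
    fun F => by simp [basisMap, Fin.sum_univ_two]
  have hneg : ∀ c f, mulExp c (mulExp (-c) f) = f := fun c f => by
    simpa using mulExp_neg_comp (-c) f
  have hu : IsUnit W.det := isUnit_iff_ne_zero.2 hW
  have h1 := fun i j => congrFun (congrFun (Matrix.nonsing_inv_mul W hu) i) j
  have h2 := fun i j => congrFun (congrFun (Matrix.mul_nonsing_inv W hu) i) j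
  simp only [Matrix.mul_apply, Fin.sum_univ_two] at h1 h2
  refine ContinuousLinearMap.IsInvertible.of_inverse (g := B) ?_ ?_
  · ext F j : 2
    fin_cases j
    · have a := h2 0 0
      have b := h2 0 1
      simp only [ContinuousLinearMap.comp_apply, ContinuousLinearMap.id_apply, Fin.zero_eta,
        hA0, hB, hneg, map_add, map_smul, reflect_reflect]
      simp only [Matrix.one_apply_eq] at a
      simp only [Matrix.one_apply_ne (show (0 : Fin 2) ≠ 1 by decide)] at b
      linear_combination (norm := module) a • F 0 + b • reflect (F 1)
    · have a := h2 1 0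
      have b := h2 1 1
      simp only [ContinuousLinearMap.comp_apply, ContinuousLinearMap.id_apply, Fin.mk_one,
        hA1, hB, hneg]
      simp only [Matrix.one_apply_eq] at b
      simp only [Matrix.one_apply_ne (show (1 : Fin 2) ≠ 0 by decide)] at a
      linear_combination (norm := module) a • reflect (F 0) + b • F 1
  · ext F j : 2
    simp only [ContinuousLinearMap.comp_apply, ContinuousLinearMap.id_apply, hB, hA0, hA1,
      map_add, map_smul, reflect_reflect]
    fin_cases j
    · have a := h1 0 0
      have b := h1 0 1
      simp only [Matrix.one_apply_eq] at a
      simp only [Matrix.one_apply_ne (show (0 : Fin 2) ≠ 1 by decide)] at b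
      simp only [Fin.zero_eta]
      rw [mulExp_neg_comp]
      linear_combination (norm := module) a • F 0 + b • mulExp (-τ 0) (mulExp (τ 1) (F 1))
    · have a := h1 1 0
      have b := h1 1 1
      simp only [Matrix.one_apply_eq] at b
      simp only [Matrix.one_apply_ne (show (1 : Fin 2) ≠ 0 by decide)] at a
      simp only [Fin.mk_one]
      rw [mulExp_neg_comp]
      linear_combination (norm := module) a • mulExp (-τ 1) (mulExp (τ 0) (F 0)) + b • F 1

/-! ### The localizing sets -/

/-- The height `T = max (1, 2 max (|Im τ₁|, |Im τ₂|, 384 ‖A‖ ‖A⁻¹‖ ‖r‖²))`. -/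
def height (τ : Fin 2 → ℂ) (W : Matrix (Fin 2) (Fin 2) ℂ) (P Q : ℝ → ℂ) : ℝ :=
  max 1 (2 * max (max |(τ 0).im| |(τ 1).im|)
    (384 * ‖basisMap τ W‖ * ‖(basisMap τ W).inverse‖ * rNormSq τ W P Q))

/-- The rectangle `R_{NT} = {x + it : |x - Re (τ₁ + τ₂)/2| < N + 1, |t| < T}`. -/
def rectangle (τ : Fin 2 → ℂ) (N : ℕ) (T : ℝ) : Set ℂ :=
  {z | |z.re - ((τ 0 + τ 1) / 2).re| < N + 1 ∧ |z.im| < T}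

/-- The radius `ρ = min (1 - |Re (τ₁ - τ₂)|/2, |τ₁ - τ₂|/2)`. -/
def radius (τ : Fin 2 → ℂ) : ℝ :=
  min (1 - |(τ 0 - τ 1).re| / 2) (‖τ 0 - τ 1‖ / 2)

/-- The open disc `D_m^μ` of radius `ρ` with center `m + τ_μ`. -/
def disc (τ : Fin 2 → ℂ) (μ : Fin 2) (m : ℤ) : Set ℂ :=
  Metric.ball (m + τ μ) (radius τ)

end DiracBVP

end

/-!
The spectrum is localized by comparing `L(v)` with the free operator `L(0)` through the identity
`(z - L(v)) R₀(z) = 1 - V R₀(z)`: a point `z` of the resolvent set of `L(0)` is not in the spectrum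
of `L(v)` if `1 - V R₀(z)` is invertible in `L²`.

The isomorphism `A = basisMap τ W` turns the boundary condition into the periodicity of both
components and `L(0)` into the diagonal operator with entries `-i d/dx + τ_μ`
(`IsFreeData.isDiracPair_basisMap`, `IsFreeData.exists_periodic_of_isDiracPair`). The resolvent of
such an entry is an explicit integral operator, `green (z - τ_μ)`. It is bounded from `L²` to `L^∞`,
hence it can be multiplied by a potential that is merely in `L²`. In these coordinates `V` becomes a
matrix of multiplications by functions, composed with the reflection `x ↦ π - x`; the Fourier
coefficients of these functions are the numbers `w^{μν}(m)`, so that their norms are at most `‖r‖`,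
by Parseval's identity (`norm_transPotL2_sq_le`). Consequently `V R₀(z)` is a `2 × 2` matrix of
bounded operators, `blockOp`, whose norm is at most `2 ‖r‖ b`, where `b` bounds the norms of the
Green operators.

* If `|Im z| ≥ T` then `b² ≤ 20 / |Im (z - τ_μ)|` (`greenBound_le_of_im`), and the choice of `T`
  gives `‖V R₀(z)‖ < 1`.
* If `z` stays outside the discs then `b` is bounded uniformly (`exists_greenBound_le`), but
  `V R₀(z)` need not be small. Its square is small when `|Re z|` is large
  (`exists_norm_potOp_potOp_le`): for an exponential potential `g`, the reflection changes the sign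
  of `d/dx`, whence the factor `R₀ g R₀` is of the order of `1 / |z|`, and the exponentials span a
  dense subspace of `L²`. Hence `1 - (V R₀)² = (1 - V R₀)(1 + V R₀)` is invertible.

The second estimate only concerns the spectrum and the exponents `τ`, not the height `T`, so it may
be obtained from one fixed matrix of eigenvectors for each `τ`. As there are only finitely many
admissible `τ` (`finite_setOf_isFreeData`), one number `N` serves all of them.
-/

noncomputable section

namespace DiracBVP

/-! ### Absolutely continuous functions on `[0, π]` -/

theorem memLp_intervalMeasure_iff {f : ℝ → ℂ} {p : ENNReal} :
    MemLp f p intervalMeasure ↔ MemLp f p (volume.restrict (Icc 0 Real.pi)) := by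
  refine ⟨fun h => ?_, fun h => ?_⟩
  · have h2 := h.smul_measure (c := ENNReal.ofReal Real.pi) ENNReal.ofReal_ne_top
    rwa [intervalMeasure, smul_smul, ENNReal.mul_inv_cancel (by simp [Real.pi_pos])
      ENNReal.ofReal_ne_top, one_smul] at h2
  · exact h.smul_measure (by simp [Real.pi_pos])

instance isProbabilityMeasure_intervalMeasure : IsProbabilityMeasure intervalMeasure := by
  constructor
  simp only [intervalMeasure, Measure.smul_apply, Measure.restrict_apply_univ, Real.volume_Icc,
    sub_zero, smul_eq_mul]
  exact ENNReal.inv_mul_cancel (by simp [Real.pi_pos]) ENNReal.ofReal_ne_top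

theorem ae_intervalMeasure_of_forall_mem {p : ℝ → Prop} (h : ∀ x ∈ Icc 0 Real.pi, p x) :
    ∀ᵐ x ∂intervalMeasure, p x := by
  rw [ae_intervalMeasure_iff]
  exact (ae_restrict_iff' measurableSet_Icc).2 (Filter.Eventually.of_forall h)

theorem integral_intervalMeasure {E : Type*} [NormedAddCommGroup E] [NormedSpace ℝ E] (f : ℝ → E) :
    ∫ x, f x ∂intervalMeasure = Real.pi⁻¹ • ∫ x in (0 : ℝ)..Real.pi, f x := by
  rw [intervalMeasure, integral_smul_measure, integral_Icc_eq_integral_Ioc,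
    ← intervalIntegral.integral_of_le Real.pi_pos.le, ENNReal.toReal_inv,
    ENNReal.toReal_ofReal Real.pi_pos.le]

theorem pi_sub_mem {x : ℝ} (hx : x ∈ Icc 0 Real.pi) : Real.pi - x ∈ Icc 0 Real.pi :=
  ⟨by linarith [hx.2], by linarith [hx.1]⟩

theorem MemLp.comp_pi_sub {f : ℝ → ℂ} {p : ENNReal} (hf : MemLp f p intervalMeasure) :
    MemLp (fun x => f (Real.pi - x)) p intervalMeasure :=
  hf.comp_measurePreserving measurePreserving_reflect

theorem MemLp.exp_mul {f : ℝ → ℂ} (hf : MemLp f 2 intervalMeasure) (c : ℂ) :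
    MemLp (fun x : ℝ => Complex.exp (Complex.I * c * x) * f x) 2 intervalMeasure :=
  hf.mul (p := ⊤) (memLp_exp c)

theorem ContinuousOn.memLp_intervalMeasure {f : ℝ → ℂ} (hf : ContinuousOn f (Icc 0 Real.pi))
    (p : ENNReal) : MemLp f p intervalMeasure := by
  obtain ⟨B, hB⟩ := (isCompact_Icc (a := (0 : ℝ)) (b := Real.pi)).exists_bound_of_continuousOn hf
  have h : MemLp f ⊤ intervalMeasure := by
    refine memLp_top_of_bound ?_ B (ae_intervalMeasure_of_forall_mem hB)
    exact (hf.aestronglyMeasurable measurableSet_Icc).smul_measure _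
  exact h.mono_exponent le_top

theorem absolutelyContinuousOnInterval_congr {f g : ℝ → ℂ} {a b : ℝ}
    (hf : AbsolutelyContinuousOnInterval f a b) (h : ∀ x ∈ uIcc a b, g x = f x) :
    AbsolutelyContinuousOnInterval g a b := by
  rw [absolutelyContinuousOnInterval_iff] at hf ⊢
  intro ε hε
  obtain ⟨δ, hδ, H⟩ := hf ε hε
  refine ⟨δ, hδ, fun E hE hl => ?_⟩
  have e : ∀ i ∈ Finset.range E.1, dist (g (E.2 i).1) (g (E.2 i).2) =
      dist (f (E.2 i).1) (f (E.2 i).2) := fun i hi => by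
    rw [h _ (hE.1 i hi).1, h _ (hE.1 i hi).2]
  rw [Finset.sum_congr rfl e]
  exact H E hE hl

/-- The primitive of an integrable complex function is absolutely continuous. -/
theorem absolutelyContinuousOnInterval_primitive {g : ℝ → ℂ} {a b : ℝ}
    (hg : IntervalIntegrable g volume a b) :
    AbsolutelyContinuousOnInterval (fun x => ∫ t in a..x, g t) a b := by
  have hre : IntervalIntegrable (fun t => (g t).re) volume a b :=
    ⟨hg.1.re, hg.2.re⟩
  have him : IntervalIntegrable (fun t => (g t).im) volume a b :=
    ⟨hg.1.im, hg.2.im⟩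
  have hc : ∀ w : ℂ, AbsolutelyContinuousOnInterval (fun _ : ℝ => w) a b := fun w =>
    ContDiffOn.absolutelyContinuousOnInterval contDiffOn_const
  have h := ((hre.absolutelyContinuousOnInterval_intervalIntegral (c := a) left_mem_uIcc).smul
      (hc 1)).add
    ((him.absolutelyContinuousOnInterval_intervalIntegral (c := a) left_mem_uIcc).smul
      (hc Complex.I))
  refine absolutelyContinuousOnInterval_congr h fun x hx => ?_
  have hgx : IntervalIntegrable g volume a x := hg.mono_set (uIcc_subset_uIcc_left hx)
  have e1 := Complex.reCLM.intervalIntegral_comp_comm hgx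
  have e2 := Complex.imCLM.intervalIntegral_comp_comm hgx
  simp only [Complex.reCLM_apply, Complex.imCLM_apply] at e1 e2
  simp only [Pi.add_apply, Pi.smul_apply', e1, e2, Complex.real_smul, mul_one, Complex.re_add_im]

theorem IsACWithDeriv.continuousOn {y g : ℝ → ℂ} (h : IsACWithDeriv y g) :
    ContinuousOn y (Icc 0 Real.pi) := by
  have hint : IntervalIntegrable g volume 0 Real.pi :=
    MemLp.intervalIntegrable_of_intervalMeasure h.memLp ⟨Real.pi_pos.le, le_rfl⟩
  have h1 := intervalIntegral.continuousOn_primitive_interval' (μ := volume) hint left_mem_uIcc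
  rw [uIcc_of_le Real.pi_pos.le] at h1
  exact (continuousOn_const.add h1).congr h.eq_integral

theorem IsACWithDeriv.memLp_self {y g : ℝ → ℂ} (h : IsACWithDeriv y g) :
    MemLp y 2 intervalMeasure :=
  ContinuousOn.memLp_intervalMeasure h.continuousOn 2

theorem IsACWithDeriv.add {y g y' g' : ℝ → ℂ} (h : IsACWithDeriv y g)
    (h' : IsACWithDeriv y' g') :
    IsACWithDeriv (fun x => y x + y' x) (fun x => g x + g' x) := by
  refine ⟨h.memLp.add h'.memLp, fun x hx => ?_⟩
  rw [intervalIntegral.integral_add (MemLp.intervalIntegrable_of_intervalMeasure h.memLp hx)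
    (MemLp.intervalIntegrable_of_intervalMeasure h'.memLp hx)]
  linear_combination h.eq_integral x hx + h'.eq_integral x hx

theorem IsACWithDeriv.const_mul {y g : ℝ → ℂ} (h : IsACWithDeriv y g) (c : ℂ) :
    IsACWithDeriv (fun x => c * y x) (fun x => c * g x) := by
  refine ⟨h.memLp.const_mul c, fun x hx => ?_⟩
  rw [intervalIntegral.integral_const_mul]
  linear_combination c * h.eq_integral x hx

theorem IsACWithDeriv.reflect {y g : ℝ → ℂ} (h : IsACWithDeriv y g) :
    IsACWithDeriv (fun x => y (Real.pi - x)) (fun x => -g (Real.pi - x)) := by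
  refine ⟨(MemLp.comp_pi_sub h.memLp).neg, fun x hx => ?_⟩
  have hx' := pi_sub_mem hx
  have h1 := MemLp.intervalIntegrable_of_intervalMeasure h.memLp hx'
  have h2 := MemLp.intervalIntegrable_of_intervalMeasure h.memLp ⟨Real.pi_pos.le, le_rfl⟩
  have h3 := intervalIntegral.integral_interval_sub_left h2 h1
  rw [intervalIntegral.integral_neg, intervalIntegral.integral_comp_sub_left (fun t => g t),
    sub_zero, ← h3]
  linear_combination h.eq_integral _ hx' - h.eq_integral _ ⟨Real.pi_pos.le, le_rfl⟩

theorem IsACWithDeriv.congr {y g y' g' : ℝ → ℂ} (h : IsACWithDeriv y g)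
    (hy : ∀ x ∈ Icc 0 Real.pi, y' x = y x) (hg : ∀ᵐ x ∂intervalMeasure, g' x = g x) :
    IsACWithDeriv y' g' := by
  refine ⟨h.memLp.ae_eq (by filter_upwards [hg] with x hx using hx.symm), fun x hx => ?_⟩
  rw [hy x hx, hy 0 ⟨le_rfl, Real.pi_pos.le⟩, h.eq_integral x hx]
  congr 1
  refine intervalIntegral.integral_congr_ae ?_
  rw [ae_intervalMeasure_iff, ae_restrict_iff' measurableSet_Icc] at hg
  filter_upwards [hg] with t ht htx
  rw [uIoc_of_le hx.1] at htx
  exact (ht ⟨htx.1.le, htx.2.trans hx.2⟩).symm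

theorem IsACWithDeriv.of_primitive {g : ℝ → ℂ} (hg : MemLp g 2 intervalMeasure) (c : ℂ) :
    IsACWithDeriv (fun x => c + ∫ t in (0 : ℝ)..x, g t) g :=
  ⟨hg, fun x _ => by simp⟩

/-- The product rule for an absolutely continuous function and an exponential. -/
theorem IsACWithDeriv.exp_mul {y g : ℝ → ℂ} (h : IsACWithDeriv y g) (c : ℂ) :
    IsACWithDeriv (fun x => Complex.exp (Complex.I * c * x) * y x)
      (fun x => Complex.exp (Complex.I * c * x) * (g x + Complex.I * c * y x)) := by
  have hmem : MemLp (fun x : ℝ => Complex.exp (Complex.I * c * x) * (g x + Complex.I * c * y x)) 2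
      intervalMeasure := MemLp.exp_mul (h.memLp.add (h.memLp_self.const_mul _)) c
  have hpi : Real.pi ∈ Icc 0 Real.pi := ⟨Real.pi_pos.le, le_rfl⟩
  have hg := MemLp.intervalIntegrable_of_intervalMeasure h.memLp hpi
  have hk := MemLp.intervalIntegrable_of_intervalMeasure hmem hpi
  have hexp : ∀ x : ℝ, HasDerivAt (fun x : ℝ => Complex.exp (Complex.I * c * x))
      (Complex.exp (Complex.I * c * x) * (Complex.I * c)) x := fun x => by
    have := (((hasDerivAt_id (x : ℂ)).const_mul (Complex.I * c)).cexp).comp_ofReal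
    simpa using this
  have hacE : AbsolutelyContinuousOnInterval (fun x : ℝ => Complex.exp (Complex.I * c * x)) 0
      Real.pi := by
    refine ContDiffOn.absolutelyContinuousOnInterval (ContDiff.contDiffOn ?_)
    exact (contDiff_const.mul Complex.ofRealCLM.contDiff).cexp
  have hacY : AbsolutelyContinuousOnInterval (fun x => y 0 + ∫ t in (0 : ℝ)..x, g t) 0 Real.pi :=
    (ContDiffOn.absolutelyContinuousOnInterval contDiffOn_const).add
      (absolutelyContinuousOnInterval_primitive hg)
  -- the difference of both sides is absolutely continuous, and its derivative vanishes a.e.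
  have hac := (hacE.smul hacY).sub (absolutelyContinuousOnInterval_primitive hk)
  obtain ⟨C, hC⟩ := hac.const_of_ae_hasDerivAt_zero (by
    filter_upwards [hg.ae_hasDerivAt_integral, hk.ae_hasDerivAt_integral] with x h1 h2 hx
    have e1 := (hexp x).mul ((h1 hx 0 left_mem_uIcc).const_add (y 0))
    have e2 := e1.sub (h2 hx 0 left_mem_uIcc)
    rw [uIcc_of_le Real.pi_pos.le] at hx
    rw [← h.eq_integral x hx] at e2
    convert! e2 using 1
    ring)
  rw [uIcc_of_le Real.pi_pos.le] at hC
  refine ⟨hmem, fun x hx => ?_⟩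
  have h0 := hC 0 ⟨le_rfl, Real.pi_pos.le⟩
  have h1 := hC x hx
  simp only [Pi.sub_apply, smul_eq_mul, Pi.mul_apply, intervalIntegral.integral_same,
    add_zero] at h0 h1
  rw [← h.eq_integral x hx] at h1
  linear_combination h1 - h0

/-! ### The Green operator of the periodic first order problem -/

/-- The solution `y` of `i y' + l y = f`, `y 0 = y π`, provided that `l` is not an even integer. If
`l` is an even integer then this is `0`, because of the division by zero. -/
def green (l : ℂ) (f : ℝ → ℂ) (x : ℝ) : ℂ :=
  -Complex.I / (1 - Complex.exp (Complex.I * l * Real.pi)) *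
    ((∫ t in (0 : ℝ)..x, Complex.exp (Complex.I * l * (x - t)) * f t) +
      ∫ t in x..Real.pi, Complex.exp (Complex.I * l * (x + Real.pi - t)) * f t)

theorem green_eq_exp_mul (l : ℂ) (f : ℝ → ℂ) (x : ℝ) :
    green l f x = -Complex.I / (1 - Complex.exp (Complex.I * l * Real.pi)) *
      Complex.exp (Complex.I * l * x) *
      ((∫ t in (0 : ℝ)..x, Complex.exp (Complex.I * (-l) * t) * f t) +
      Complex.exp (Complex.I * l * Real.pi) *
        ∫ t in x..Real.pi, Complex.exp (Complex.I * (-l) * t) * f t) := by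
  have e1 : ∀ t : ℝ, Complex.exp (Complex.I * l * (x - t)) * f t =
      Complex.exp (Complex.I * l * x) * (Complex.exp (Complex.I * (-l) * t) * f t) := fun t => by
    rw [← mul_assoc, ← Complex.exp_add]
    ring_nf
  have e2 : ∀ t : ℝ, Complex.exp (Complex.I * l * (x + Real.pi - t)) * f t =
      Complex.exp (Complex.I * l * x) * Complex.exp (Complex.I * l * Real.pi) *
        (Complex.exp (Complex.I * (-l) * t) * f t) := fun t => by
    rw [← mul_assoc, ← Complex.exp_add, ← Complex.exp_add]
    ring_nf
  simp only [green, e1, e2, intervalIntegral.integral_const_mul]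
  ring

/-- On `[0, π]`, the Green function formula in terms of a single primitive. -/
theorem green_eq_primitive {l : ℂ} (hl : Complex.exp (Complex.I * l * Real.pi) ≠ 1) {f : ℝ → ℂ}
    (hf : MemLp f 2 intervalMeasure) {x : ℝ} (hx : x ∈ Icc 0 Real.pi) :
    green l f x = Complex.exp (Complex.I * l * x) *
      (-Complex.I * Complex.exp (Complex.I * l * Real.pi) /
          (1 - Complex.exp (Complex.I * l * Real.pi)) *
          (∫ t in (0 : ℝ)..Real.pi, Complex.exp (Complex.I * (-l) * t) * f t) +
        ∫ t in (0 : ℝ)..x, -Complex.I * (Complex.exp (Complex.I * (-l) * t) * f t)) := by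
  have hm := MemLp.exp_mul hf (-l)
  have h1 := MemLp.intervalIntegrable_of_intervalMeasure hm hx
  have h2 := MemLp.intervalIntegrable_of_intervalMeasure hm ⟨Real.pi_pos.le, le_rfl⟩
  have h3 := intervalIntegral.integral_interval_sub_left h2 h1
  have hq : 1 - Complex.exp (Complex.I * l * Real.pi) ≠ 0 := sub_ne_zero.2 hl.symm
  rw [green_eq_exp_mul, intervalIntegral.integral_const_mul, ← h3]
  field_simp
  ring

theorem isACWithDeriv_green {l : ℂ} (hl : Complex.exp (Complex.I * l * Real.pi) ≠ 1) {f : ℝ → ℂ}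
    (hf : MemLp f 2 intervalMeasure) :
    IsACWithDeriv (green l f) (fun x => Complex.I * (l * green l f x - f x)) := by
  have h := (IsACWithDeriv.of_primitive ((MemLp.exp_mul hf (-l)).const_mul (-Complex.I))
    (-Complex.I * Complex.exp (Complex.I * l * Real.pi) /
          (1 - Complex.exp (Complex.I * l * Real.pi)) *
          (∫ t in (0 : ℝ)..Real.pi, Complex.exp (Complex.I * (-l) * t) * f t))).exp_mul l
  refine h.congr (fun x hx => green_eq_primitive hl hf hx)
    (ae_intervalMeasure_of_forall_mem fun x hx => ?_)
  have e : Complex.exp (Complex.I * l * x) * Complex.exp (Complex.I * (-l) * x) = 1 := by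
    rw [← Complex.exp_add]
    simp
  rw [green_eq_primitive hl hf hx]
  linear_combination (Complex.I * f x) * e

theorem green_zero_eq_green_pi (l : ℂ) (f : ℝ → ℂ) : green l f 0 = green l f Real.pi := by
  rw [green_eq_exp_mul, green_eq_exp_mul]
  simp only [intervalIntegral.integral_same]
  simp
  ring

/-- A periodic absolutely continuous function is the Green integral of its image under
`y ↦ i y' + l y`. -/
theorem IsACWithDeriv.green_eq {l : ℂ} (hl : Complex.exp (Complex.I * l * Real.pi) ≠ 1)
    {y g : ℝ → ℂ} (h : IsACWithDeriv y g) (hper : y 0 = y Real.pi) {x : ℝ}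
    (hx : x ∈ Icc 0 Real.pi) :
    green l (fun x => Complex.I * g x + l * y x) x = y x := by
  have hf : MemLp (fun x => Complex.I * g x + l * y x) 2 intervalMeasure :=
    (h.memLp.const_mul _).add (h.memLp_self.const_mul _)
  have hE := h.exp_mul (-l)
  have e : ∀ t : ℝ, Complex.exp (Complex.I * (-l) * t) * (g t + Complex.I * (-l) * y t) =
      -Complex.I * (Complex.exp (Complex.I * (-l) * t) * (Complex.I * g t + l * y t)) := fun t => by
    linear_combination (Complex.exp (Complex.I * (-l) * t) * g t) * Complex.I_mul_I
  have h1 := hE.eq_integral x hx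
  have h2 := hE.eq_integral Real.pi ⟨Real.pi_pos.le, le_rfl⟩
  simp only [e] at h1 h2
  rw [← hper] at h2
  rw [intervalIntegral.integral_const_mul] at h2
  have hq : 1 - Complex.exp (Complex.I * l * Real.pi) ≠ 0 := sub_ne_zero.2 hl.symm
  have ex : ∀ x : ℝ, Complex.exp (Complex.I * l * x) * Complex.exp (Complex.I * (-l) * x) = 1 :=
    fun x => by rw [← Complex.exp_add]; simp
  have e0 : Complex.exp (Complex.I * (-l) * (0 : ℝ)) = 1 := by simp
  rw [e0, one_mul] at h1 h2
  rw [green_eq_primitive hl hf hx]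
  have exp_pi := ex Real.pi
  generalize (∫ t in (0 : ℝ)..Real.pi, Complex.exp (Complex.I * (-l) * t) *
    (Complex.I * g t + l * y t)) = K at h2 ⊢
  have h3 : -Complex.I * Complex.exp (Complex.I * l * Real.pi) /
          (1 - Complex.exp (Complex.I * l * Real.pi)) * K = y 0 := by
    rw [div_mul_eq_mul_div, div_eq_iff hq]
    linear_combination (-Complex.exp (Complex.I * l * Real.pi)) * h2 + y 0 * exp_pi
  rw [h3]
  linear_combination (-Complex.exp (Complex.I * l * x)) * h1 + y x * ex x

theorem green_congr_ae {l : ℂ} {f f' : ℝ → ℂ} (h : ∀ᵐ x ∂intervalMeasure, f x = f' x) {x : ℝ}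
    (hx : x ∈ Icc 0 Real.pi) : green l f x = green l f' x := by
  rw [ae_intervalMeasure_iff, ae_restrict_iff' measurableSet_Icc] at h
  have e1 : (∫ t in (0 : ℝ)..x, Complex.exp (Complex.I * l * (x - t)) * f t) =
      ∫ t in (0 : ℝ)..x, Complex.exp (Complex.I * l * (x - t)) * f' t := by
    refine intervalIntegral.integral_congr_ae ?_
    filter_upwards [h] with t ht htx
    rw [uIoc_of_le hx.1] at htx
    rw [ht ⟨htx.1.le, htx.2.trans hx.2⟩]
  have e2 : (∫ t in x..Real.pi, Complex.exp (Complex.I * l * (x + Real.pi - t)) * f t) =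
      ∫ t in x..Real.pi, Complex.exp (Complex.I * l * (x + Real.pi - t)) * f' t := by
    refine intervalIntegral.integral_congr_ae ?_
    filter_upwards [h] with t ht htx
    rw [uIoc_of_le hx.2] at htx
    rw [ht ⟨hx.1.trans htx.1.le, htx.2⟩]
  rw [green, green, e1, e2]

theorem MemLp.intervalIntegrable_left_right {g : ℝ → ℂ} (hg : MemLp g 2 intervalMeasure) {x : ℝ}
    (hx : x ∈ Icc 0 Real.pi) :
    IntervalIntegrable g volume 0 x ∧ IntervalIntegrable g volume x Real.pi := by
  have h1 := MemLp.intervalIntegrable_of_intervalMeasure hg hx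
  have h2 := MemLp.intervalIntegrable_of_intervalMeasure hg ⟨Real.pi_pos.le, le_rfl⟩
  exact ⟨h1, h1.symm.trans h2⟩

theorem green_add {l : ℂ} {f f' : ℝ → ℂ} (hf : MemLp f 2 intervalMeasure)
    (hf' : MemLp f' 2 intervalMeasure) {x : ℝ} (hx : x ∈ Icc 0 Real.pi) :
    green l (fun x => f x + f' x) x = green l f x + green l f' x := by
  obtain ⟨h1, h2⟩ := MemLp.intervalIntegrable_left_right (MemLp.exp_mul hf (-l)) hx
  obtain ⟨h1', h2'⟩ := MemLp.intervalIntegrable_left_right (MemLp.exp_mul hf' (-l)) hx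
  simp only [green_eq_exp_mul, mul_add (Complex.exp _) (f _) (f' _),
    intervalIntegral.integral_add h1 h1', intervalIntegral.integral_add h2 h2']
  ring

theorem green_const_mul {l : ℂ} (c : ℂ) (f : ℝ → ℂ) (x : ℝ) :
    green l (fun x => c * f x) x = c * green l f x := by
  simp only [green_eq_exp_mul, mul_left_comm (Complex.exp _) c, intervalIntegral.integral_const_mul]
  ring

theorem continuousOn_green (l : ℂ) {f : ℝ → ℂ} (hf : MemLp f 2 intervalMeasure) :
    ContinuousOn (green l f) (Icc 0 Real.pi) := by
  by_cases hl : Complex.exp (Complex.I * l * Real.pi) = 1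
  · have : green l f = fun _ => 0 := by
      funext x
      simp [green, hl]
    rw [this]
    exact continuousOn_const
  · exact (isACWithDeriv_green hl hf).continuousOn

/-! ### Bounds for the Green operator -/

/-- A bound for the norm of the Green operator from `L²` to `L^∞`. -/
def greenBound (l : ℂ) : ℝ :=
  2 / ‖1 - Complex.exp (Complex.I * l * Real.pi)‖ *
    √(∫ s in (0 : ℝ)..Real.pi, ‖Complex.exp (Complex.I * l * s)‖ ^ 2) * √Real.pi

theorem greenBound_nonneg (l : ℂ) : 0 ≤ greenBound l := by
  unfold greenBound
  positivity

theorem norm_exp_I_mul (l : ℂ) (s : ℝ) :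
    ‖Complex.exp (Complex.I * l * s)‖ = Real.exp (-l.im * s) := by
  rw [Complex.norm_exp]
  simp

theorem norm_L2_sq (f : L2) :
    ‖f‖ ^ 2 = Real.pi⁻¹ * ∫ x in (0 : ℝ)..Real.pi, ‖f x‖ ^ 2 := by
  have h : ‖f‖ ^ 2 = ∫ x, ‖f x‖ ^ 2 ∂intervalMeasure := by
    rw [← RCLike.ofReal_inj (K := ℂ), ← integral_ofReal]
    push_cast
    rw [← inner_self_eq_norm_sq_to_K (𝕜 := ℂ), L2.inner_def]
    simp [inner_self_eq_norm_sq_to_K]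
  rw [h, integral_intervalMeasure, smul_eq_mul]

/-- The Cauchy–Schwarz inequality for the integral of `f` against an exponential. -/
theorem norm_integral_exp_mul_le (l : ℂ) (f : L2) {a b c : ℝ} (ha : 0 ≤ a) (hab : a ≤ b)
    (hb : b ≤ Real.pi) (hbc : b ≤ c) (hca : c ≤ a + Real.pi) :
    ‖∫ t in a..b, Complex.exp (Complex.I * l * (c - t)) * f t‖ ≤
      √(∫ s in (0 : ℝ)..Real.pi, ‖Complex.exp (Complex.I * l * s)‖ ^ 2) *
        (√Real.pi * ‖f‖) := by
  have hsub : Ioc a b ⊆ Icc 0 Real.pi := fun t ht => ⟨ha.trans ht.1.le, ht.2.trans hb⟩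
  have hcont : Continuous fun t : ℝ => Complex.exp (Complex.I * l * (c - t)) := by fun_prop
  have hE : MemLp (fun t : ℝ => Complex.exp (Complex.I * l * (c - t))) 2
      (volume.restrict (Ioc a b)) :=
    (memLp_intervalMeasure_iff.1
      (ContinuousOn.memLp_intervalMeasure hcont.continuousOn 2)).mono_measure
      (Measure.restrict_mono_set _ hsub)
  have hf : MemLp f 2 (volume.restrict (Icc 0 Real.pi)) := memLp_intervalMeasure_iff.1 (Lp.memLp f)
  have hf' : MemLp f 2 (volume.restrict (Ioc a b)) :=
    hf.mono_measure (Measure.restrict_mono_set _ hsub)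
  have hH := integral_mul_norm_le_Lp_mul_Lq (μ := volume.restrict (Ioc a b))
    Real.HolderConjugate.two_two (by simpa using hE) (by simpa using hf')
  simp only [Real.rpow_two, ← Real.sqrt_eq_rpow] at hH
  have h1 : ∫ t in Ioc a b, ‖Complex.exp (Complex.I * l * (c - t))‖ ^ 2 ≤
      ∫ s in (0 : ℝ)..Real.pi, ‖Complex.exp (Complex.I * l * s)‖ ^ 2 := by
    rw [← intervalIntegral.integral_of_le hab]
    have := intervalIntegral.integral_comp_sub_left
      (fun s : ℝ => ‖Complex.exp (Complex.I * l * s)‖ ^ 2) (a := a) (b := b) c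
    push_cast at this
    rw [this]
    refine intervalIntegral.integral_mono_interval (by linarith) (by linarith) (by linarith)
      (Filter.Eventually.of_forall fun _ => by positivity) (Continuous.intervalIntegrable ?_ _ _)
    fun_prop
  have h2 : ∫ t in Ioc a b, ‖f t‖ ^ 2 ≤ Real.pi * ‖f‖ ^ 2 := by
    rw [norm_L2_sq, ← mul_assoc, mul_inv_cancel₀ Real.pi_pos.ne', one_mul,
      intervalIntegral.integral_of_le Real.pi_pos.le]
    refine setIntegral_mono_set ?_ (Filter.Eventually.of_forall fun _ => by positivity)
      (LE.le.eventuallyLE (Ioc_subset_Ioc ha hb))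
    exact IntegrableOn.mono_set (hf.integrable_norm_pow (by norm_num)) Ioc_subset_Icc_self
  rw [intervalIntegral.integral_of_le hab]
  refine (norm_integral_le_integral_norm _).trans ?_
  simp only [norm_mul]
  refine hH.trans ?_
  have h3 := Real.sqrt_le_sqrt h2
  rw [Real.sqrt_mul Real.pi_pos.le, Real.sqrt_sq (norm_nonneg f)] at h3
  exact mul_le_mul (Real.sqrt_le_sqrt h1) h3 (by positivity) (by positivity)

theorem norm_green_le (l : ℂ) (f : L2) {x : ℝ} (hx : x ∈ Icc 0 Real.pi) :
    ‖green l f x‖ ≤ greenBound l * ‖f‖ := by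
  have h1 := norm_integral_exp_mul_le l f (a := 0) (b := x) (c := x) le_rfl hx.1 hx.2 le_rfl
    (by linarith [hx.2])
  have h2 := norm_integral_exp_mul_le l f (a := x) (b := Real.pi) (c := x + Real.pi) hx.1 hx.2
    le_rfl (by linarith [hx.1]) le_rfl
  push_cast at h2
  rw [green, norm_mul, norm_div, norm_neg, Complex.norm_I]
  refine (mul_le_mul_of_nonneg_left ((norm_add_le _ _).trans (add_le_add h1 h2))
    (by positivity)).trans (le_of_eq ?_)
  rw [greenBound]
  ring

theorem one_sub_exp_bound {t : ℝ} (ht : Real.pi / 2 ≤ t) : (3 / 5 : ℝ) ≤ 1 - Real.exp (-t) := by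
  have h1 : Real.exp (-t) ≤ Real.exp (-(3 / 2)) :=
    Real.exp_le_exp.2 (by linarith [Real.pi_gt_three])
  have h2 : (5 / 2 : ℝ) ≤ Real.exp (3 / 2) := by linarith [Real.add_one_le_exp (3 / 2 : ℝ)]
  have h3 : Real.exp (-(3 / 2)) ≤ 2 / 5 := by
    rw [Real.exp_neg]
    calc (Real.exp (3 / 2))⁻¹ ≤ (5 / 2 : ℝ)⁻¹ := inv_anti₀ (by norm_num) h2
      _ = 2 / 5 := by norm_num
  linarith

/-- Away from the real axis, the denominator of the Green function is not small. -/
theorem max_le_norm_one_sub_exp {l : ℂ} (hl : 1 / 2 ≤ |l.im|) :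
    3 / 5 * max 1 ‖Complex.exp (Complex.I * l * Real.pi)‖ ≤
      ‖1 - Complex.exp (Complex.I * l * Real.pi)‖ := by
  have hb := one_sub_exp_bound (t := |l.im| * Real.pi) (by nlinarith [Real.pi_pos])
  have hn := norm_exp_I_mul l Real.pi
  have h1 := norm_sub_norm_le 1 (Complex.exp (Complex.I * l * Real.pi))
  have h2 := norm_sub_norm_le (Complex.exp (Complex.I * l * Real.pi)) 1
  rw [norm_sub_rev] at h2
  rw [norm_one] at h1 h2
  rcases le_total 0 l.im with h | h
  · rw [abs_of_nonneg h, ← neg_mul, ← hn] at hb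
    rw [max_eq_left (by linarith)]
    linarith
  · rw [abs_of_nonpos h] at hb
    have hpos : 0 < ‖Complex.exp (Complex.I * l * Real.pi)‖ := by
      rw [hn]
      exact Real.exp_pos _
    have hinv : Real.exp (-(-l.im * Real.pi)) =
        ‖Complex.exp (Complex.I * l * Real.pi)‖⁻¹ := by rw [hn, Real.exp_neg]
    rw [hinv] at hb
    have h3 : ‖Complex.exp (Complex.I * l * Real.pi)‖⁻¹ ≤ 2 / 5 := by linarith
    have h4 := mul_le_mul_of_nonneg_right h3 hpos.le
    rw [inv_mul_cancel₀ hpos.ne'] at h4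
    rw [max_eq_right (by linarith)]
    linarith

theorem greenBound_le_of_im {l : ℂ} (hl : 1 / 2 ≤ |l.im|) : greenBound l ^ 2 * |l.im| ≤ 20 := by
  have hn := norm_exp_I_mul l Real.pi
  have hden := max_le_norm_one_sub_exp hl
  have him : l.im ≠ 0 := fun h => by norm_num [h] at hl
  have hE : (∫ s in (0 : ℝ)..Real.pi, ‖Complex.exp (Complex.I * l * s)‖ ^ 2) * |l.im| ≤
      max 1 ‖Complex.exp (Complex.I * l * Real.pi)‖ ^ 2 / 2 := by
    have e : ∀ s : ℝ, ‖Complex.exp (Complex.I * l * s)‖ ^ 2 = Real.exp ((-2 * l.im) * s) :=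
      fun s => by
        rw [norm_exp_I_mul, ← Real.exp_nat_mul]
        ring_nf
    have e2 := e Real.pi
    simp only [e]
    rw [intervalIntegral.integral_comp_mul_left (fun s => Real.exp s) (by simpa using him),
      integral_exp, mul_zero, Real.exp_zero, smul_eq_mul, ← e2]
    rcases le_total 0 l.im with h | h
    · have h1 : max 1 ‖Complex.exp (Complex.I * l * Real.pi)‖ = 1 := by
        refine max_eq_left ?_
        rw [hn]
        exact Real.exp_le_one_iff.2 (by nlinarith [Real.pi_pos])
      rw [h1, abs_of_nonneg h]
      have : (-2 * l.im)⁻¹ * (‖Complex.exp (Complex.I * l * Real.pi)‖ ^ 2 - 1) * l.im =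
        (1 - ‖Complex.exp (Complex.I * l * Real.pi)‖ ^ 2) / 2 := by
          field_simp
          ring
      rw [this]
      nlinarith [sq_nonneg ‖Complex.exp (Complex.I * l * Real.pi)‖]
    · have h1 : max 1 ‖Complex.exp (Complex.I * l * Real.pi)‖ =
          ‖Complex.exp (Complex.I * l * Real.pi)‖ := by
        refine max_eq_right ?_
        rw [hn]
        exact Real.one_le_exp_iff.2 (by nlinarith [Real.pi_pos])
      rw [h1, abs_of_nonpos h]
      have : (-2 * l.im)⁻¹ * (‖Complex.exp (Complex.I * l * Real.pi)‖ ^ 2 - 1) * -l.im =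
        (‖Complex.exp (Complex.I * l * Real.pi)‖ ^ 2 - 1) / 2 := by
          field_simp
      rw [this]
      linarith
  have hE0 : 0 ≤ ∫ s in (0 : ℝ)..Real.pi, ‖Complex.exp (Complex.I * l * s)‖ ^ 2 :=
    intervalIntegral.integral_nonneg Real.pi_pos.le fun _ _ => by positivity
  have hm : (1 : ℝ) ≤ max 1 ‖Complex.exp (Complex.I * l * Real.pi)‖ := le_max_left _ _
  have hpos : 0 < ‖1 - Complex.exp (Complex.I * l * Real.pi)‖ := by linarith
  rw [greenBound, mul_pow, mul_pow, Real.sq_sqrt hE0, Real.sq_sqrt Real.pi_pos.le]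
  calc (2 / ‖1 - Complex.exp (Complex.I * l * Real.pi)‖) ^ 2 *
        (∫ s in (0 : ℝ)..Real.pi, ‖Complex.exp (Complex.I * l * s)‖ ^ 2) * Real.pi * |l.im|
      = 4 * Real.pi * ((∫ s in (0 : ℝ)..Real.pi, ‖Complex.exp (Complex.I * l * s)‖ ^ 2) * |l.im|) /
        ‖1 - Complex.exp (Complex.I * l * Real.pi)‖ ^ 2 := by ring
    _ ≤ 20 := by
      rw [div_le_iff₀ (by positivity)]
      have h1 : (3 / 5 * max 1 ‖Complex.exp (Complex.I * l * Real.pi)‖) ^ 2 ≤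
        ‖1 - Complex.exp (Complex.I * l * Real.pi)‖ ^ 2 := pow_le_pow_left₀ (by positivity) hden 2
      have h2 := mul_le_mul_of_nonneg_left hE (show 0 ≤ 4 * Real.pi by positivity)
      have h3 : Real.pi * max 1 ‖Complex.exp (Complex.I * l * Real.pi)‖ ^ 2 ≤
        3.15 * max 1 ‖Complex.exp (Complex.I * l * Real.pi)‖ ^ 2 :=
          mul_le_mul_of_nonneg_right Real.pi_lt_d2.le (by positivity)
      nlinarith

theorem greenBound_le_div (l : ℂ) : greenBound l ≤
    2 * Real.pi * (max 1 ‖Complex.exp (Complex.I * l * Real.pi)‖ /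
      ‖1 - Complex.exp (Complex.I * l * Real.pi)‖) := by
  have hm : (1 : ℝ) ≤ max 1 ‖Complex.exp (Complex.I * l * Real.pi)‖ := le_max_left _ _
  have hE : (∫ s in (0 : ℝ)..Real.pi, ‖Complex.exp (Complex.I * l * s)‖ ^ 2) ≤
      Real.pi * max 1 ‖Complex.exp (Complex.I * l * Real.pi)‖ ^ 2 := by
    calc (∫ s in (0 : ℝ)..Real.pi, ‖Complex.exp (Complex.I * l * s)‖ ^ 2)
        ≤ ∫ s in (0 : ℝ)..Real.pi, max 1 ‖Complex.exp (Complex.I * l * Real.pi)‖ ^ 2 := by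
          refine intervalIntegral.integral_mono_on Real.pi_pos.le
            (Continuous.intervalIntegrable (by fun_prop) _ _) (by simp) fun s hs => ?_
          refine pow_le_pow_left₀ (norm_nonneg _) ?_ 2
          rw [norm_exp_I_mul, norm_exp_I_mul]
          rcases le_total 0 l.im with h | h
          · exact le_max_of_le_left (Real.exp_le_one_iff.2 (by nlinarith [hs.1]))
          · exact le_max_of_le_right (Real.exp_le_exp.2 (by nlinarith [hs.2]))
      _ = _ := by simp
  have h1 := Real.sqrt_le_sqrt hE
  rw [Real.sqrt_mul Real.pi_pos.le, Real.sqrt_sq (by positivity)] at h1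
  rw [greenBound]
  calc _ ≤ 2 / ‖1 - Complex.exp (Complex.I * l * Real.pi)‖ *
        (√Real.pi * max 1 ‖Complex.exp (Complex.I * l * Real.pi)‖) * √Real.pi := by gcongr
    _ = 2 * (√Real.pi * √Real.pi) * (max 1 ‖Complex.exp (Complex.I * l * Real.pi)‖ /
          ‖1 - Complex.exp (Complex.I * l * Real.pi)‖) := by ring
    _ = _ := by rw [Real.mul_self_sqrt Real.pi_pos.le]

theorem exp_I_mul_pi_eq_one_iff (l : ℂ) :
    Complex.exp (Complex.I * l * Real.pi) = 1 ↔ ∃ n : ℤ, l = 2 * n := by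
  rw [Complex.exp_eq_one_iff]
  have hpi : (Real.pi : ℂ) ≠ 0 := Complex.ofReal_ne_zero.2 Real.pi_ne_zero
  refine exists_congr fun n => ⟨fun h => ?_, fun h => ?_⟩
  · refine mul_left_cancel₀ (mul_ne_zero Complex.I_ne_zero hpi) ?_
    linear_combination h
  · rw [h]
    ring

/-- The norm of the Green operator is bounded uniformly in the complement of discs about the even
integers. -/
theorem exists_greenBound_le {r : ℝ} (hr : 0 < r) :
    ∃ C : ℝ, ∀ l : ℂ, (∀ n : ℤ, r ≤ ‖l - 2 * n‖) →
      Complex.exp (Complex.I * l * Real.pi) ≠ 1 ∧ greenBound l ≤ C := by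
  have hne : ∀ l : ℂ, (∀ n : ℤ, r ≤ ‖l - 2 * n‖) →
      Complex.exp (Complex.I * l * Real.pi) ≠ 1 := fun l hl h => by
    obtain ⟨n, hn⟩ := (exp_I_mul_pi_eq_one_iff l).1 h
    have := hl n
    rw [hn, sub_self, norm_zero] at this
    linarith
  let K : Set ℂ := (Icc (-1) 1 ×ℂ Icc (-1 / 2) (1 / 2)) ∩ {l | ∀ n : ℤ, r ≤ ‖l - 2 * n‖}
  have hclosed : IsClosed {l : ℂ | ∀ n : ℤ, r ≤ ‖l - 2 * n‖} := by
    simp only [ofPred_forall]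
    exact isClosed_iInter fun n => isClosed_le continuous_const (by fun_prop)
  have hK : IsCompact K := (isCompact_Icc.reProdIm isCompact_Icc).inter_right hclosed
  have hcont : ContinuousOn (fun l : ℂ => max 1 ‖Complex.exp (Complex.I * l * Real.pi)‖ /
      ‖1 - Complex.exp (Complex.I * l * Real.pi)‖) K := by
    refine ContinuousOn.div (Continuous.continuousOn (by fun_prop))
      (Continuous.continuousOn (by fun_prop)) fun l hl => ?_
    exact norm_ne_zero_iff.2 (sub_ne_zero.2 (hne l hl.2).symm)
  obtain ⟨C, hC⟩ := hK.exists_bound_of_continuousOn hcont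
  refine ⟨2 * Real.pi * max C (5 / 3), fun l hl => ⟨hne l hl, (greenBound_le_div l).trans ?_⟩⟩
  refine mul_le_mul_of_nonneg_left ?_ (by positivity)
  have hpos : 0 < ‖1 - Complex.exp (Complex.I * l * Real.pi)‖ :=
    norm_pos_iff.2 (sub_ne_zero.2 (hne l hl).symm)
  rcases le_total (1 / 2) |l.im| with h | h
  · refine le_max_of_le_right ?_
    rw [div_le_iff₀ hpos]
    linarith [max_le_norm_one_sub_exp h]
  · refine le_max_of_le_left ?_
    -- translate `l` by an even integer into the compact set `K`
    have hper : Complex.exp (Complex.I * (l - 2 * (round (l.re / 2) : ℤ)) * Real.pi) =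
        Complex.exp (Complex.I * l * Real.pi) := by
      rw [← Complex.exp_periodic.int_mul (round (l.re / 2))]
      congr 1
      ring
    have hmem : l - 2 * (round (l.re / 2) : ℤ) ∈ K := by
      refine ⟨?_, fun n => ?_⟩
      · rw [Complex.mem_reProdIm]
        have h1 := abs_le.1 (abs_sub_round (l.re / 2))
        have h2 := abs_le.1 h
        simp only [Complex.sub_re, Complex.mul_re, Complex.re_ofNat, Complex.intCast_re,
          Complex.im_ofNat, Complex.intCast_im, mul_zero, sub_zero, Complex.sub_im, Complex.mul_im,
          zero_mul, add_zero, mem_Icc]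
        refine ⟨⟨?_, ?_⟩, ?_, ?_⟩ <;> linarith [h1.1, h1.2, h2.1, h2.2]
      · have := hl (round (l.re / 2) + n)
        push_cast at this
        rwa [mul_add, ← sub_sub] at this
    have := hC _ hmem
    rw [hper] at this
    exact (le_abs_self _).trans this

/-! ### The Green operator followed by the potential -/

theorem memLp_green (l : ℂ) (f : L2) (p : ENNReal) : MemLp (green l f) p intervalMeasure :=
  ContinuousOn.memLp_intervalMeasure (continuousOn_green l (Lp.memLp f)) p

theorem norm_Lp_top_le {F : Lp ℂ ⊤ intervalMeasure} {C : ℝ} (hC : 0 ≤ C)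
    (h : ∀ᵐ x ∂intervalMeasure, ‖F x‖ ≤ C) : ‖F‖ ≤ C := by
  simpa using Lp.norm_le_of_ae_bound hC h

/-- The Green operator as a bounded operator from `L²` to `L^∞`. -/
def greenOp (l : ℂ) : L2 →L[ℂ] Lp ℂ ⊤ intervalMeasure :=
  LinearMap.mkContinuous
    { toFun := fun f => (memLp_green l f ⊤).toLp _
      map_add' := fun f g => by
        rw [← MemLp.toLp_add, MemLp.toLp_eq_toLp_iff]
        refine ae_intervalMeasure_of_forall_mem fun x hx => ?_
        rw [Pi.add_apply, ← green_add (Lp.memLp f) (Lp.memLp g) hx]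
        exact green_congr_ae (Lp.coeFn_add f g) hx
      map_smul' := fun c f => by
        rw [RingHom.id_apply, ← MemLp.toLp_const_smul, MemLp.toLp_eq_toLp_iff]
        refine ae_intervalMeasure_of_forall_mem fun x hx => ?_
        rw [Pi.smul_apply, smul_eq_mul, ← green_const_mul]
        exact green_congr_ae (Lp.coeFn_smul c f) hx }
    (greenBound l) fun f => by
      refine norm_Lp_top_le (mul_nonneg (greenBound_nonneg l) (norm_nonneg f)) ?_
      filter_upwards [(memLp_green l f ⊤).coeFn_toLp,
        ae_intervalMeasure_of_forall_mem fun x hx => norm_green_le l f hx] with x h1 h2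
      exact (congrArg norm h1).trans_le h2

theorem greenOp_apply (l : ℂ) (f : L2) : ∀ᵐ x ∂intervalMeasure, greenOp l f x = green l f x :=
  (memLp_green l f ⊤).coeFn_toLp

theorem norm_greenOp_apply_le {l : ℂ} {f : L2} {C : ℝ} (hC : 0 ≤ C)
    (h : ∀ x ∈ Icc 0 Real.pi, ‖green l f x‖ ≤ C) : ‖greenOp l f‖ ≤ C := by
  refine norm_Lp_top_le hC ?_
  filter_upwards [greenOp_apply l f, ae_intervalMeasure_of_forall_mem h] with x h1 h2
  rwa [h1]

/-- Multiplication of a function in `L²` by a bounded function. -/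
def mulBdd : L2 →L[ℂ] Lp ℂ ⊤ intervalMeasure →L[ℂ] L2 :=
  (ContinuousLinearMap.mul ℂ ℂ).holderL intervalMeasure 2 ⊤ 2

theorem mulBdd_apply (g : L2) (F : Lp ℂ ⊤ intervalMeasure) :
    ∀ᵐ x ∂intervalMeasure, mulBdd g F x = g x * F x :=
  (ContinuousLinearMap.mul ℂ ℂ).coeFn_holder (r := 2) g F

theorem norm_mulBdd_apply_le (g : L2) (F : Lp ℂ ⊤ intervalMeasure) :
    ‖mulBdd g F‖ ≤ ‖g‖ * ‖F‖ := by
  have h := (ContinuousLinearMap.mul ℂ ℂ).norm_holder_apply_apply_le (r := 2) g F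
  have h1 : ‖ContinuousLinearMap.mul ℂ ℂ‖ ≤ 1 := ContinuousLinearMap.opNorm_mul_le ℂ ℂ
  refine h.trans ?_
  rw [mul_assoc]
  exact mul_le_of_le_one_left (by positivity) h1

/-- The Green operator as a bounded operator in `L²`. -/
def resOp (l : ℂ) : L2 →L[ℂ] L2 :=
  mulBdd ((memLp_const (1 : ℂ)).toLp _) ∘L greenOp l

theorem resOp_apply (l : ℂ) (f : L2) : ∀ᵐ x ∂intervalMeasure, resOp l f x = green l f x := by
  filter_upwards [mulBdd_apply ((memLp_const (1 : ℂ)).toLp _) (greenOp l f), greenOp_apply l f,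
    (memLp_const (μ := intervalMeasure) (p := 2) (1 : ℂ)).coeFn_toLp] with x h1 h2 h3
  rw [resOp, ContinuousLinearMap.comp_apply, h1, h2, h3, one_mul]

/-- The Green operator, followed by the multiplication by `g` and by the reflection of the
interval. -/
def potOp (l : ℂ) (g : L2) : L2 →L[ℂ] L2 :=
  reflect ∘L mulBdd g ∘L greenOp l

theorem potOp_apply (l : ℂ) (g f : L2) :
    ∀ᵐ x ∂intervalMeasure, potOp l g f x = g (Real.pi - x) * green l f (Real.pi - x) := by
  have hq := measurePreserving_reflect.quasiMeasurePreserving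
  filter_upwards [reflect_apply (mulBdd g (greenOp l f)),
    hq.ae (mulBdd_apply g (greenOp l f)), hq.ae (greenOp_apply l f)] with x h1 h2 h3
  rw [potOp, ContinuousLinearMap.comp_apply, ContinuousLinearMap.comp_apply, h1, h2, h3]

theorem potOp_add (l : ℂ) (g g' f : L2) : potOp l (g + g') f = potOp l g f + potOp l g' f := by
  simp [potOp]

theorem potOp_smul (l c : ℂ) (g f : L2) : potOp l (c • g) f = c • potOp l g f := by
  simp [potOp]

theorem norm_reflect (f : L2) : ‖reflect f‖ = ‖f‖ :=
  (Lp.compMeasurePreservingₗᵢ ℂ (fun x : ℝ => Real.pi - x) measurePreserving_reflect).norm_map f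

theorem norm_potOp_apply_le_greenOp (l : ℂ) (g f : L2) :
    ‖potOp l g f‖ ≤ ‖g‖ * ‖greenOp l f‖ := by
  rw [potOp, ContinuousLinearMap.comp_apply, ContinuousLinearMap.comp_apply, norm_reflect]
  exact norm_mulBdd_apply_le g _

theorem norm_potOp_apply_le (l : ℂ) (g f : L2) :
    ‖potOp l g f‖ ≤ ‖g‖ * (greenBound l * ‖f‖) :=
  (norm_potOp_apply_le_greenOp l g f).trans (mul_le_mul_of_nonneg_left
    (norm_greenOp_apply_le (mul_nonneg (greenBound_nonneg l) (norm_nonneg f))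
      fun _ hx => norm_green_le l f hx) (norm_nonneg g))

/-! ### Exponentials -/

/-- The function `exp(2inx)` as an element of `L²`. -/
def expL2 (n : ℤ) : L2 := ((memLp_exp (2 * n)).mono_exponent le_top).toLp _

theorem expL2_apply (n : ℤ) :
    ∀ᵐ x ∂intervalMeasure, expL2 n x = Complex.exp (Complex.I * (2 * n) * x) :=
  ((memLp_exp (2 * n)).mono_exponent le_top).coeFn_toLp

theorem norm_mulExp_int (n : ℤ) (f : L2) : ‖mulExp (2 * n) f‖ ≤ ‖f‖ := by
  refine Lp.norm_le_norm_of_ae_le ?_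
  filter_upwards [mulExp_apply (2 * n) f] with x hx
  rw [hx, norm_mul, norm_exp_I_mul]
  simp

theorem exp_two_int_pi (n : ℤ) : Complex.exp (Complex.I * (2 * n) * Real.pi) = 1 :=
  (exp_I_mul_pi_eq_one_iff _).2 ⟨n, rfl⟩

/-- If the potential is an exponential, the product of two resolvents with the potential between
them is of the order of the inverse of the sum of the spectral parameters: the reflection turns
`d/dx` into `-d/dx`, so that the exponential times the reflected first Green integral almost solves
the second equation, with the sum of the parameters as a factor. -/
theorem norm_potOp_potOp_expL2_le {l l' : ℂ} (hl : Complex.exp (Complex.I * l * Real.pi) ≠ 1)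
    (hl' : Complex.exp (Complex.I * l' * Real.pi) ≠ 1) (n : ℤ) (a f : L2) :
    ‖potOp l' a (potOp l (expL2 n) f)‖ * ‖l + l' + 2 * n‖ ≤
      (greenBound l + greenBound l') * ‖a‖ * ‖f‖ := by
  set u := green l f
  have hu : IsACWithDeriv u _ := isACWithDeriv_green hl (Lp.memLp f)
  have hy := (hu.exp_mul (2 * n)).reflect
  set y : ℝ → ℂ := fun x => Complex.exp (Complex.I * (2 * n) * (Real.pi - x : ℝ)) * u (Real.pi - x)
  have hper : y 0 = y Real.pi := by
    simp only [y, sub_zero, sub_self, exp_two_int_pi, Complex.ofReal_zero, mul_zero,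
      Complex.exp_zero]
    rw [show u Real.pi = u 0 from (green_zero_eq_green_pi l f).symm]
  set k : L2 := reflect (mulExp (2 * n) f)
  have hk : ∀ᵐ x ∂intervalMeasure,
      k x = Complex.exp (Complex.I * (2 * n) * (Real.pi - x : ℝ)) * f (Real.pi - x) := by
    filter_upwards [reflect_apply (mulExp (2 * n) f),
      measurePreserving_reflect.quasiMeasurePreserving.ae (mulExp_apply (2 * n) f)] with x h1 h2
    rw [h1, h2]
  set h : L2 := potOp l (expL2 n) f
  have hh : ∀ᵐ x ∂intervalMeasure, h x = y x := by
    filter_upwards [potOp_apply l (expL2 n) f,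
      measurePreserving_reflect.quasiMeasurePreserving.ae (expL2_apply n)] with x h1 h2
    rw [h1, h2]
  -- `i y' + l' y = (l + l' + 2n) y - k`, to which the Green operator for `l'` is applied
  have key : ∀ x ∈ Icc 0 Real.pi, (l + l' + 2 * n) * green l' h x = y x + green l' k x := by
    intro x hx
    have h1 := hy.green_eq hl' hper hx
    have h2 : green l' (fun x => (l + l' + 2 * n) * h x) x =
        green l' (fun t => (Complex.I * -(Complex.exp (Complex.I * (2 * n) * (Real.pi - t : ℝ)) *
          (Complex.I * (l * u (Real.pi - t) - f (Real.pi - t)) +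
            Complex.I * (2 * n) * u (Real.pi - t))) + l' * y t) + k t) x := by
      refine green_congr_ae ?_ hx
      filter_upwards [hh, hk] with t e1 e2
      rw [e1, e2]
      simp only [y]
      linear_combination (Complex.exp (Complex.I * (2 * n) * (Real.pi - t : ℝ)) *
        ((l * u (Real.pi - t) - f (Real.pi - t)) + (2 * n) * u (Real.pi - t))) * Complex.I_mul_I
    rw [green_const_mul, green_add _ (Lp.memLp k) hx, h1] at h2
    · exact h2
    · exact (hy.memLp.const_mul _).add (hy.memLp_self.const_mul _)
  have hyb : ∀ x ∈ Icc 0 Real.pi, ‖y x‖ ≤ greenBound l * ‖f‖ := fun x hx => by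
    simp only [y]
    rw [norm_mul, norm_exp_I_mul]
    simpa using norm_green_le l f (pi_sub_mem hx)
  have hkn : ‖k‖ ≤ ‖f‖ := (norm_reflect _).trans_le (norm_mulExp_int n f)
  have hb := greenBound_nonneg l
  have hb' := greenBound_nonneg l'
  rcases eq_or_ne (l + l' + 2 * n) 0 with h0 | h0
  · rw [h0, norm_zero, mul_zero]
    positivity
  have hpos : 0 < ‖l + l' + 2 * n‖ := norm_pos_iff.2 h0
  have hG : ‖greenOp l' h‖ ≤ (greenBound l + greenBound l') * ‖f‖ / ‖l + l' + 2 * n‖ := by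
    refine norm_greenOp_apply_le (by positivity) fun x hx => ?_
    rw [le_div_iff₀ hpos, mul_comm, ← norm_mul, key x hx]
    refine (norm_add_le _ _).trans ?_
    have h1 := hyb x hx
    have h2 := (norm_green_le l' k hx).trans (mul_le_mul_of_nonneg_left hkn hb')
    linarith
  calc ‖potOp l' a h‖ * ‖l + l' + 2 * n‖ ≤ ‖a‖ * ‖greenOp l' h‖ * ‖l + l' + 2 * n‖ := by
        gcongr
        exact norm_potOp_apply_le_greenOp l' a h
    _ ≤ ‖a‖ * ((greenBound l + greenBound l') * ‖f‖ / ‖l + l' + 2 * n‖) * ‖l + l' + 2 * n‖ := by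
        gcongr
    _ = (greenBound l + greenBound l') * ‖a‖ * ‖f‖ := by
        field_simp

theorem fourierCoeffOn_eq (g : ℝ → ℂ) (n : ℤ) :
    fourierCoeffOn Real.pi_pos g (-n) =
      ∫ x, Complex.exp (Complex.I * (2 * n) * x) * g x ∂intervalMeasure := by
  rw [fourierCoeffOn_eq_integral, integral_intervalMeasure, sub_zero, one_div]
  congr 1
  refine intervalIntegral.integral_congr fun x _ => ?_
  have hpi : (Real.pi : ℂ) ≠ 0 := Complex.ofReal_ne_zero.2 Real.pi_ne_zero
  simp only [neg_neg, fourier_coe_apply, smul_eq_mul]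
  congr 2
  field_simp

/-- Parseval's identity. -/
theorem hasSum_sq_norm_fourier (g : L2) :
    HasSum (fun n : ℤ => ‖∫ x, Complex.exp (Complex.I * (2 * n) * x) * g x ∂intervalMeasure‖ ^ 2)
      (‖g‖ ^ 2) := by
  have hg : MemLp g 2 (volume.restrict (Ioc 0 Real.pi)) :=
    (memLp_intervalMeasure_iff.1 (Lp.memLp g)).mono_measure
      (Measure.restrict_mono_set _ Ioc_subset_Icc_self)
  have h := (Equiv.neg ℤ).hasSum_iff.2 (hasSum_sq_fourierCoeffOn Real.pi_pos hg)
  rw [sub_zero, smul_eq_mul, ← norm_L2_sq] at h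
  convert h using 2 with n
  simp only [Function.comp_apply, Equiv.neg_apply, fourierCoeffOn_eq]

theorem span_expL2_dense : (Submodule.span ℂ (range expL2)).topologicalClosure = ⊤ := by
  rw [Submodule.topologicalClosure_eq_top_iff, Submodule.eq_bot_iff]
  intro g hg
  have h0 : ∀ n : ℤ,
      ∫ x, Complex.exp (Complex.I * (2 * n) * x) * g x ∂intervalMeasure = 0 := fun n => by
    have h1 := (Submodule.mem_orthogonal _ _).1 hg (expL2 (-n))
      (Submodule.subset_span (mem_range_self _))
    rw [L2.inner_def] at h1
    rw [← h1]
    refine integral_congr_ae ?_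
    filter_upwards [expL2_apply (-n)] with x hx
    rw [hx, RCLike.inner_apply, ← Complex.exp_conj, mul_comm]
    congr 2
    simp [map_ofNat (starRingEnd ℂ) 2]
  have h := hasSum_sq_norm_fourier g
  simp only [h0, norm_zero, ne_eq, OfNat.ofNat_ne_zero, not_false_eq_true, zero_pow] at h
  have := h.unique hasSum_zero
  simpa using this

/-- For an arbitrary potential `g` in `L²`, the product of two resolvents with the potential between
them tends to zero as the sum of the spectral parameters tends to infinity. -/
theorem exists_norm_potOp_potOp_le (C : ℝ) (g : L2) {ε : ℝ} (hε : 0 < ε) :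
    ∃ N : ℝ, ∀ l l' : ℂ, Complex.exp (Complex.I * l * Real.pi) ≠ 1 →
      Complex.exp (Complex.I * l' * Real.pi) ≠ 1 → greenBound l ≤ C → greenBound l' ≤ C →
      N ≤ ‖l + l'‖ → ∀ a f : L2, ‖potOp l' a (potOp l g f)‖ ≤ ε * ‖a‖ * ‖f‖ := by
  have hspan : ∀ g ∈ Submodule.span ℂ (range expL2), ∀ ε : ℝ, 0 < ε →
      ∃ N : ℝ, ∀ l l' : ℂ, Complex.exp (Complex.I * l * Real.pi) ≠ 1 →
      Complex.exp (Complex.I * l' * Real.pi) ≠ 1 → greenBound l ≤ C → greenBound l' ≤ C →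
      N ≤ ‖l + l'‖ → ∀ a f : L2, ‖potOp l' a (potOp l g f)‖ ≤ ε * ‖a‖ * ‖f‖ := by
    intro g hg
    induction hg using Submodule.span_induction with
    | mem g hg =>
      obtain ⟨n, rfl⟩ := hg
      intro ε hε
      refine ⟨‖(2 * n : ℂ)‖ + 1 + 2 * C / ε, fun l l' h1 h2 h3 h4 h5 a f => ?_⟩
      have hC : 0 ≤ C := (greenBound_nonneg l).trans h3
      have h6 : 1 + 2 * C / ε ≤ ‖l + l' + 2 * n‖ := by
        have := norm_sub_le (l + l' + 2 * n) (2 * n)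
        rw [add_sub_cancel_right] at this
        linarith
      have h7 := norm_potOp_potOp_expL2_le h1 h2 n a f
      have hpos : 0 < 1 + 2 * C / ε := by positivity
      have h8 : (greenBound l + greenBound l') * ‖a‖ * ‖f‖ ≤ (2 * C) * (‖a‖ * ‖f‖) := by
        rw [mul_assoc]
        gcongr
        linarith
      have h9 : ‖potOp l' a (potOp l (expL2 n) f)‖ * (1 + 2 * C / ε) ≤ 2 * C * (‖a‖ * ‖f‖) :=
        (mul_le_mul_of_nonneg_left h6 (norm_nonneg _)).trans (h7.trans h8)
      rw [← le_div_iff₀ hpos] at h9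
      refine h9.trans ?_
      rw [div_le_iff₀ hpos]
      have : ε * ‖a‖ * ‖f‖ * (1 + 2 * C / ε) = 2 * C * (‖a‖ * ‖f‖) + ε * ‖a‖ * ‖f‖ := by
        field_simp
        ring
      rw [this]
      have : 0 ≤ ε * ‖a‖ * ‖f‖ := by positivity
      linarith
    | zero =>
      intro ε hε
      refine ⟨0, fun l l' _ _ _ _ _ a f => ?_⟩
      have : potOp l 0 f = 0 := by simp [potOp]
      rw [this, map_zero, norm_zero]
      positivity
    | add g g' _ _ ih ih' =>
      intro ε hε
      obtain ⟨N, hN⟩ := ih (ε / 2) (by positivity)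
      obtain ⟨N', hN'⟩ := ih' (ε / 2) (by positivity)
      refine ⟨max N N', fun l l' h1 h2 h3 h4 h5 a f => ?_⟩
      rw [potOp_add, map_add]
      refine (norm_add_le _ _).trans ((add_le_add
        (hN l l' h1 h2 h3 h4 ((le_max_left _ _).trans h5) a f)
        (hN' l l' h1 h2 h3 h4 ((le_max_right _ _).trans h5) a f)).trans (le_of_eq ?_))
      ring
    | smul c g _ ih =>
      intro ε hε
      obtain ⟨N, hN⟩ := ih (ε / (‖c‖ + 1)) (by positivity)
      refine ⟨N, fun l l' h1 h2 h3 h4 h5 a f => ?_⟩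
      rw [potOp_smul, map_smul, norm_smul]
      refine (mul_le_mul_of_nonneg_left (hN l l' h1 h2 h3 h4 h5 a f) (norm_nonneg c)).trans ?_
      have h6 : ‖c‖ * (ε / (‖c‖ + 1)) ≤ ε := by
        rw [mul_div_assoc', div_le_iff₀ (by positivity)]
        nlinarith [norm_nonneg c]
      calc ‖c‖ * (ε / (‖c‖ + 1) * ‖a‖ * ‖f‖) = ‖c‖ * (ε / (‖c‖ + 1)) * (‖a‖ * ‖f‖) := by ring
        _ ≤ ε * (‖a‖ * ‖f‖) := by gcongr
        _ = _ := by ring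
  have hgd : g ∈ (Submodule.span ℂ (range expL2)).topologicalClosure := by
    rw [span_expL2_dense]
    exact Submodule.mem_top
  obtain ⟨g', hg', hd⟩ := Metric.mem_closure_iff.1 hgd (ε / 2 / (C ^ 2 + 1)) (by positivity)
  obtain ⟨N, hN⟩ := hspan g' hg' (ε / 2) (by positivity)
  refine ⟨N, fun l l' h1 h2 h3 h4 h5 a f => ?_⟩
  rw [dist_eq_norm] at hd
  have e : potOp l g f = potOp l (g - g') f + potOp l g' f := by
    rw [← potOp_add, sub_add_cancel]
  have h6 : ‖potOp l' a (potOp l (g - g') f)‖ ≤ ε / 2 * ‖a‖ * ‖f‖ := by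
    have b1 := norm_potOp_apply_le l' a (potOp l (g - g') f)
    have b2 := norm_potOp_apply_le l (g - g') f
    have hb := greenBound_nonneg l
    have hb' := greenBound_nonneg l'
    have hC : 0 ≤ C := hb.trans h3
    calc ‖potOp l' a (potOp l (g - g') f)‖
        ≤ ‖a‖ * (greenBound l' * (‖g - g'‖ * (greenBound l * ‖f‖))) := by
          refine b1.trans ?_
          gcongr
      _ ≤ ‖a‖ * (C * (ε / 2 / (C ^ 2 + 1) * (C * ‖f‖))) := by gcongr
      _ = (C ^ 2 / (C ^ 2 + 1)) * (ε / 2 * ‖a‖ * ‖f‖) := by ring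
      _ ≤ 1 * (ε / 2 * ‖a‖ * ‖f‖) := by
          refine mul_le_mul_of_nonneg_right ?_ (by positivity)
          rw [div_le_one (by positivity)]
          linarith
      _ = _ := one_mul _
  rw [e, map_add]
  refine (norm_add_le _ _).trans ((add_le_add h6 (hN l l' h1 h2 h3 h4 h5 a f)).trans (le_of_eq ?_))
  ring

/-! ### Reduction to periodic problems -/

/-- The entries of the potential in the coordinates given by `basisMap`: with `A = basisMap τ W`,
the operator `A⁻¹ V A` maps `F` to the function whose component `μ` is
`∑ ν, transPot μ ν (π - x) * F ν (π - x)`. -/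
def transPot (τ : Fin 2 → ℂ) (W : Matrix (Fin 2) (Fin 2) ℂ) (P Q : ℝ → ℂ) (μ ν : Fin 2) (x : ℝ) :
    ℂ :=
  Complex.exp (Complex.I * (τ ν + τ μ) * x) * (Complex.exp (Complex.I * (-τ μ) * Real.pi) *
    (W⁻¹ μ 0 * W 1 ν * P x + W⁻¹ μ 1 * W 0 ν * Q (Real.pi - x)))

theorem memLp_transPot (τ : Fin 2 → ℂ) (W : Matrix (Fin 2) (Fin 2) ℂ) {P Q : ℝ → ℂ}
    (hP : MemLp P 2 intervalMeasure) (hQ : MemLp Q 2 intervalMeasure) (μ ν : Fin 2) :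
    MemLp (transPot τ W P Q μ ν) 2 intervalMeasure :=
  MemLp.exp_mul (((hP.const_mul _).add ((MemLp.comp_pi_sub hQ).const_mul _)).const_mul _) _

theorem mul_inv_entry {W : Matrix (Fin 2) (Fin 2) ℂ} (hW : W.det ≠ 0) (i j : Fin 2) :
    W i 0 * W⁻¹ 0 j + W i 1 * W⁻¹ 1 j = if i = j then 1 else 0 := by
  have h := congrFun (congrFun (Matrix.mul_nonsing_inv W (isUnit_iff_ne_zero.2 hW)) i) j
  rwa [Matrix.mul_apply, Fin.sum_univ_two, Matrix.one_apply] at h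

theorem IsFreeData.minor_mul_col {M : Matrix (Fin 2) (Fin 4) ℂ} {τ : Fin 2 → ℂ}
    {W : Matrix (Fin 2) (Fin 2) ℂ} (h : IsFreeData M τ W) (hM : (minor M 0 3).det ≠ 0)
    (i ν : Fin 2) :
    M i 1 * W 0 ν + M i 2 * W 1 ν =
      -Complex.exp (Complex.I * τ ν * Real.pi) * (M i 0 * W 0 ν + M i 3 * W 1 ν) := by
  have h1 := congrArg (minor M 0 3).mulVec (h.eigen ν)
  rw [normalMatrix, Matrix.mulVec_mulVec, ← mul_assoc,
    Matrix.mul_nonsing_inv _ (isUnit_iff_ne_zero.2 hM), one_mul, Matrix.mulVec_smul] at h1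
  have h2 := congrFun h1 i
  simp only [Matrix.mulVec, dotProduct, Fin.sum_univ_two, minor, Matrix.submatrix_apply, id_eq,
    Pi.smul_apply, smul_eq_mul, Matrix.col_apply, Matrix.cons_val_zero, Matrix.cons_val_one] at h2
  rw [h2, mul_right_comm Complex.I (τ ν)]

theorem satisfiesBC_iff (M : Matrix (Fin 2) (Fin 4) ℂ) (y : Fin 2 → ℝ → ℂ) :
    SatisfiesBC M y ↔ ∀ i, M i 0 * y 0 0 + M i 1 * y 0 Real.pi + M i 2 * y 1 0 +
      M i 3 * y 1 Real.pi = 0 := by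
  rw [SatisfiesBC, funext_iff]
  refine forall_congr' fun i => ?_
  simp [Matrix.mulVec, dotProduct, Fin.sum_univ_four]

/-- A boundary condition on `A F` is the periodicity of `F`. -/
theorem IsFreeData.satisfiesBC_iff_periodic {M : Matrix (Fin 2) (Fin 4) ℂ} {τ : Fin 2 → ℂ}
    {W : Matrix (Fin 2) (Fin 2) ℂ} (h : IsFreeData M τ W) (hM : (minor M 0 3).det ≠ 0)
    {F y : Fin 2 → ℝ → ℂ}
    (h00 : y 0 0 = ∑ ν, W 0 ν * (Complex.exp (Complex.I * τ ν * Real.pi) * F ν Real.pi))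
    (h0p : y 0 Real.pi = ∑ ν, W 0 ν * F ν 0)
    (h10 : y 1 0 = ∑ ν, W 1 ν * F ν 0)
    (h1p : y 1 Real.pi = ∑ ν, W 1 ν * (Complex.exp (Complex.I * τ ν * Real.pi) * F ν Real.pi)) :
    SatisfiesBC M y ↔ ∀ ν, F ν 0 = F ν Real.pi := by
  set d : Fin 2 → ℂ := fun ν => Complex.exp (Complex.I * τ ν * Real.pi) * (F ν Real.pi - F ν 0)
    with hd
  have e : ∀ i, M i 0 * y 0 0 + M i 1 * y 0 Real.pi + M i 2 * y 1 0 + M i 3 * y 1 Real.pi =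
      ((minor M 0 3 * W).mulVec d) i := fun i => by
    have c0 := h.minor_mul_col hM i 0
    have c1 := h.minor_mul_col hM i 1
    simp only [h00, h0p, h10, h1p, hd, Matrix.mulVec, dotProduct, Matrix.mul_apply,
      Fin.sum_univ_two, minor, Matrix.submatrix_apply, id_eq, Matrix.cons_val_zero,
      Matrix.cons_val_one]
    linear_combination F 0 0 * c0 + F 1 0 * c1
  have hdet : (minor M 0 3 * W).det ≠ 0 := by
    rw [Matrix.det_mul]
    exact mul_ne_zero hM h.det_ne_zero
  rw [satisfiesBC_iff]
  simp only [e]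
  constructor
  · intro h0 ν
    have h1 : d = 0 := Matrix.eq_zero_of_mulVec_eq_zero hdet (funext h0)
    have h2 := congrFun h1 ν
    simp only [hd, Pi.zero_apply, mul_eq_zero, Complex.exp_ne_zero, false_or] at h2
    exact (sub_eq_zero.1 h2).symm
  · intro h0 i
    have h1 : d = 0 := funext fun ν => by simp [hd, h0 ν]
    rw [h1, Matrix.mulVec_zero, Pi.zero_apply]

theorem exp_mul_transPot_zero (τ : Fin 2 → ℂ) (W : Matrix (Fin 2) (Fin 2) ℂ) (P Q : ℝ → ℂ)
    (μ ν : Fin 2) (x : ℝ) :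
    Complex.exp (Complex.I * τ μ * (Real.pi - x)) * transPot τ W P Q μ ν x =
      Complex.exp (Complex.I * τ ν * x) *
        (W⁻¹ μ 0 * W 1 ν * P x + W⁻¹ μ 1 * W 0 ν * Q (Real.pi - x)) := by
  rw [transPot, ← mul_assoc, ← mul_assoc, ← Complex.exp_add, ← Complex.exp_add]
  congr 2
  ring

theorem exp_mul_transPot_one (τ : Fin 2 → ℂ) (W : Matrix (Fin 2) (Fin 2) ℂ) (P Q : ℝ → ℂ)
    (μ ν : Fin 2) (x : ℝ) :
    Complex.exp (Complex.I * τ μ * x) * transPot τ W P Q μ ν (Real.pi - x) =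
      Complex.exp (Complex.I * τ ν * (Real.pi - x)) *
        (W⁻¹ μ 0 * W 1 ν * P (Real.pi - x) + W⁻¹ μ 1 * W 0 ν * Q x) := by
  rw [transPot, ← mul_assoc, ← mul_assoc, ← Complex.exp_add, ← Complex.exp_add, sub_sub_cancel]
  congr 2
  push_cast
  ring

theorem isDiracPair_of {M : Matrix (Fin 2) (Fin 4) ℂ} {P Q y₀ y₁ g₀ g₁ : ℝ → ℂ} {u w : H}
    (h₀ : IsACWithDeriv y₀ g₀) (h₁ : IsACWithDeriv y₁ g₁) (hbc : SatisfiesBC M ![y₀, y₁])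
    (hu₀ : ∀ᵐ x ∂intervalMeasure, u 0 x = y₀ x) (hu₁ : ∀ᵐ x ∂intervalMeasure, u 1 x = y₁ x)
    (hw₀ : ∀ᵐ x ∂intervalMeasure, w 0 x = Complex.I * g₀ x + P x * y₁ x)
    (hw₁ : ∀ᵐ x ∂intervalMeasure, w 1 x = -Complex.I * g₁ x + Q x * y₀ x) :
    IsDiracPair M P Q u w :=
  ⟨![y₀, y₁], ![g₀, g₁], Fin.forall_fin_two.2 ⟨h₀, h₁⟩, hbc, Fin.forall_fin_two.2 ⟨hu₀, hu₁⟩,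
    hw₀, hw₁⟩

/-- The map `A` transforms a solution of a periodic problem into a solution of the problem for the
Dirac operator. -/
theorem IsFreeData.isDiracPair_basisMap {M : Matrix (Fin 2) (Fin 4) ℂ} {τ : Fin 2 → ℂ}
    {W : Matrix (Fin 2) (Fin 2) ℂ} (h : IsFreeData M τ W) (hM : (minor M 0 3).det ≠ 0)
    {P Q : ℝ → ℂ} {F dF : Fin 2 → ℝ → ℂ} (hF : ∀ ν, IsACWithDeriv (F ν) (dF ν))
    (hper : ∀ ν, F ν 0 = F ν Real.pi) {U E : H} (hU : ∀ ν, ∀ᵐ x ∂intervalMeasure, U ν x = F ν x)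
    (hE : ∀ μ, ∀ᵐ x ∂intervalMeasure, E μ x = τ μ * F μ x - Complex.I * dF μ x +
      (transPot τ W P Q μ 0 (Real.pi - x) * F 0 (Real.pi - x) +
        transPot τ W P Q μ 1 (Real.pi - x) * F 1 (Real.pi - x))) :
    IsDiracPair M P Q (basisMap τ W U) (basisMap τ W E) := by
  have hW := h.det_ne_zero
  have hq := measurePreserving_reflect.quasiMeasurePreserving
  have hY := fun ν => (hF ν).exp_mul (τ ν)
  refine isDiracPair_of (((hY 0).reflect.const_mul (W 0 0)).add ((hY 1).reflect.const_mul (W 0 1)))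
    (((hY 0).const_mul (W 1 0)).add ((hY 1).const_mul (W 1 1))) ?_ ?_ ?_ ?_ ?_
  · refine (h.satisfiesBC_iff_periodic hM (F := F) ?_ ?_ ?_ ?_).2 hper
    all_goals simp [Fin.sum_univ_two]
  · filter_upwards [basisMap_apply_zero τ W U, hq.ae (hU 0), hq.ae (hU 1)] with x h1 h2 h3
    rw [h1, h2, h3]
    push_cast
    ring
  · filter_upwards [basisMap_apply_one τ W U, hU 0, hU 1] with x h1 h2 h3
    rw [h1, h2, h3]
    ring
  · filter_upwards [basisMap_apply_zero τ W E, hq.ae (hE 0), hq.ae (hE 1)] with x h1 h2 h3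
    rw [h1, h2, h3, sub_sub_cancel]
    have e := exp_mul_transPot_zero τ W P Q
    have a := mul_inv_entry hW 0 0
    have b := mul_inv_entry hW 0 1
    rw [if_pos rfl] at a
    rw [if_neg (by decide)] at b
    push_cast
    linear_combination W 0 0 * F 0 x * e 0 0 x + W 0 0 * F 1 x * e 0 1 x +
      W 0 1 * F 0 x * e 1 0 x + W 0 1 * F 1 x * e 1 1 x +
      (W 1 0 * Complex.exp (Complex.I * τ 0 * x) * F 0 x +
        W 1 1 * Complex.exp (Complex.I * τ 1 * x) * F 1 x) * P x * a +
      (W 0 0 * Complex.exp (Complex.I * τ 0 * x) * F 0 x +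
        W 0 1 * Complex.exp (Complex.I * τ 1 * x) * F 1 x) * Q (Real.pi - x) * b +
      (W 0 0 * Complex.exp (Complex.I * τ 0 * (Real.pi - x)) * τ 0 * F 0 (Real.pi - x) +
        W 0 1 * Complex.exp (Complex.I * τ 1 * (Real.pi - x)) * τ 1 * F 1 (Real.pi - x)) *
        Complex.I_mul_I
  · filter_upwards [basisMap_apply_one τ W E, hE 0, hE 1] with x h1 h2 h3
    rw [h1, h2, h3]
    have e := exp_mul_transPot_one τ W P Q
    have a := mul_inv_entry hW 1 0
    have b := mul_inv_entry hW 1 1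
    rw [if_pos rfl] at b
    rw [if_neg (by decide)] at a
    push_cast
    linear_combination W 1 0 * F 0 (Real.pi - x) * e 0 0 x + W 1 0 * F 1 (Real.pi - x) * e 0 1 x +
      W 1 1 * F 0 (Real.pi - x) * e 1 0 x + W 1 1 * F 1 (Real.pi - x) * e 1 1 x +
      (W 1 0 * Complex.exp (Complex.I * τ 0 * (Real.pi - x)) * F 0 (Real.pi - x) +
        W 1 1 * Complex.exp (Complex.I * τ 1 * (Real.pi - x)) * F 1 (Real.pi - x)) *
        P (Real.pi - x) * a +
      (W 0 0 * Complex.exp (Complex.I * τ 0 * (Real.pi - x)) * F 0 (Real.pi - x) +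
        W 0 1 * Complex.exp (Complex.I * τ 1 * (Real.pi - x)) * F 1 (Real.pi - x)) * Q x * b +
      (W 1 0 * Complex.exp (Complex.I * τ 0 * x) * τ 0 * F 0 x +
        W 1 1 * Complex.exp (Complex.I * τ 1 * x) * τ 1 * F 1 x) * Complex.I_mul_I

/-- Every element of the domain of the Dirac operator is the image under `A` of an absolutely
continuous periodic function. -/
theorem IsFreeData.exists_periodic_of_isDiracPair {M : Matrix (Fin 2) (Fin 4) ℂ} {τ : Fin 2 → ℂ}
    {W : Matrix (Fin 2) (Fin 2) ℂ} (h : IsFreeData M τ W) (hM : (minor M 0 3).det ≠ 0)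
    {P Q : ℝ → ℂ} {u w : H} (huw : IsDiracPair M P Q u w) :
    ∃ (F dF : Fin 2 → ℝ → ℂ) (U : H), (∀ ν, IsACWithDeriv (F ν) (dF ν)) ∧
      (∀ ν, F ν 0 = F ν Real.pi) ∧ (∀ ν, ∀ᵐ x ∂intervalMeasure, U ν x = F ν x) ∧
      basisMap τ W U = u := by
  obtain ⟨y, g, hy, hbc, hu, -, -⟩ := huw
  have hW := h.det_ne_zero
  have hq := measurePreserving_reflect.quasiMeasurePreserving
  have hF := fun ν =>
    (((hy 0).reflect.const_mul (W⁻¹ ν 0)).add ((hy 1).const_mul (W⁻¹ ν 1))).exp_mul (-τ ν)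
  set F : Fin 2 → ℝ → ℂ := fun ν x => Complex.exp (Complex.I * (-τ ν) * x) *
    (W⁻¹ ν 0 * y 0 (Real.pi - x) + W⁻¹ ν 1 * y 1 x) with hFdef
  have hmem : ∀ ν, MemLp (F ν) 2 intervalMeasure := fun ν => (hF ν).memLp_self
  have ex : ∀ (ν : Fin 2) (x : ℝ),
      Complex.exp (Complex.I * τ ν * x) * Complex.exp (Complex.I * (-τ ν) * x) = 1 := fun ν x => by
    rw [← Complex.exp_add]
    simp
  have hinv : ∀ x, y 0 (Real.pi - x) =
      W 0 0 * (Complex.exp (Complex.I * τ 0 * x) * F 0 x) +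
        W 0 1 * (Complex.exp (Complex.I * τ 1 * x) * F 1 x) ∧
      y 1 x = W 1 0 * (Complex.exp (Complex.I * τ 0 * x) * F 0 x) +
        W 1 1 * (Complex.exp (Complex.I * τ 1 * x) * F 1 x) := fun x => by
    simp only [hFdef, ← mul_assoc (Complex.exp (Complex.I * τ _ * x)), ex, one_mul]
    have a := mul_inv_entry hW 0 0
    have b := mul_inv_entry hW 0 1
    have c := mul_inv_entry hW 1 0
    have d := mul_inv_entry hW 1 1
    rw [if_pos rfl] at a d
    rw [if_neg (by decide)] at b c
    constructor
    · linear_combination (-y 0 (Real.pi - x)) * a - y 1 x * b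
    · linear_combination (-y 0 (Real.pi - x)) * c - y 1 x * d
  let U : H := WithLp.toLp 2 fun ν => (hmem ν).toLp _
  have hU : ∀ ν, ∀ᵐ x ∂intervalMeasure, U ν x = F ν x := fun ν => (hmem ν).coeFn_toLp
  refine ⟨F, _, U, hF, ?_, hU, ?_⟩
  · refine (h.satisfiesBC_iff_periodic hM (F := F) (y := y) ?_ ?_ ?_ ?_).1 hbc
    · simpa [Fin.sum_univ_two] using (hinv Real.pi).1
    · simpa [Fin.sum_univ_two] using (hinv 0).1
    · simpa [Fin.sum_univ_two] using (hinv 0).2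
    · simpa [Fin.sum_univ_two] using (hinv Real.pi).2
  · ext j : 1
    refine Lp.ext ?_
    fin_cases j
    · filter_upwards [basisMap_apply_zero τ W U, hq.ae (hU 0), hq.ae (hU 1), hu 0] with x h1 h2 h3 h4
      refine h1.trans ?_
      have h5 := (hinv (Real.pi - x)).1
      rw [sub_sub_cancel] at h5
      simp only [Fin.zero_eta]
      rw [h2, h3, h4, h5]
      push_cast
      ring
    · filter_upwards [basisMap_apply_one τ W U, hU 0, hU 1, hu 1] with x h1 h2 h3 h4
      refine h1.trans ?_
      simp only [Fin.mk_one]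
      rw [h2, h3, h4, (hinv x).2]
      ring

/-! ### The resolvent -/

/-- The matrix of the operators `potOp`: in the coordinates given by `basisMap`, this is the product
of the potential and the resolvent of the free operator. -/
def blockOp (l : Fin 2 → ℂ) (G : Fin 2 → Fin 2 → L2) : H →L[ℂ] H :=
  (PiLp.continuousLinearEquiv 2 ℂ (fun _ : Fin 2 => L2)).symm.toContinuousLinearMap ∘L
    ContinuousLinearMap.pi fun μ =>
      ∑ ν, potOp (l ν) (G μ ν) ∘L PiLp.proj 2 (fun _ : Fin 2 => L2) ν

theorem blockOp_apply (l : Fin 2 → ℂ) (G : Fin 2 → Fin 2 → L2) (F : H) (μ : Fin 2) :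
    blockOp l G F μ = potOp (l 0) (G μ 0) (F 0) + potOp (l 1) (G μ 1) (F 1) := by
  simp [blockOp, Fin.sum_univ_two]

/-- The resolvent of the free operator in the coordinates given by `basisMap`. -/
def diagRes (l : Fin 2 → ℂ) : H →L[ℂ] H :=
  (PiLp.continuousLinearEquiv 2 ℂ (fun _ : Fin 2 => L2)).symm.toContinuousLinearMap ∘L
    ContinuousLinearMap.pi fun μ => resOp (l μ) ∘L PiLp.proj 2 (fun _ : Fin 2 => L2) μ

theorem diagRes_apply (l : Fin 2 → ℂ) (F : H) (μ : Fin 2) :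
    diagRes l F μ = resOp (l μ) (F μ) := by
  simp [diagRes]

/-- The identity `(z - L) R₀ = 1 - V R₀`, where `R₀` is the resolvent of the free operator, in the
coordinates given by `basisMap`. -/
theorem IsFreeData.isDiracPair_diagRes {M : Matrix (Fin 2) (Fin 4) ℂ} {τ : Fin 2 → ℂ}
    {W : Matrix (Fin 2) (Fin 2) ℂ} (h : IsFreeData M τ W) (hM : (minor M 0 3).det ≠ 0)
    {P Q : ℝ → ℂ} {z : ℂ} (hz : ∀ μ, Complex.exp (Complex.I * (z - τ μ) * Real.pi) ≠ 1)
    {G : Fin 2 → Fin 2 → L2}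
    (hG : ∀ μ ν, ∀ᵐ x ∂intervalMeasure, G μ ν x = transPot τ W P Q μ ν x) (k : H) :
    IsDiracPair M P Q (basisMap τ W (diagRes (fun μ => z - τ μ) k))
      (basisMap τ W (z • diagRes (fun μ => z - τ μ) k -
        (k - blockOp (fun μ => z - τ μ) G k))) := by
  have hq := measurePreserving_reflect.quasiMeasurePreserving
  have hU : ∀ ν, ∀ᵐ x ∂intervalMeasure,
      diagRes (fun μ => z - τ μ) k ν x = green (z - τ ν) (k ν) x := fun ν => by
    rw [diagRes_apply]
    exact resOp_apply _ _
  refine h.isDiracPair_basisMap hM (F := fun ν => green (z - τ ν) (k ν))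
    (fun ν => isACWithDeriv_green (hz ν) (Lp.memLp (k ν)))
    (fun ν => green_zero_eq_green_pi _ _) hU fun μ => ?_
  set T := blockOp (fun μ => z - τ μ) G
  set S := diagRes (fun μ => z - τ μ)
  have e : (z • S k - (k - T k)) μ = z • S k μ - (k μ - (potOp (z - τ 0) (G μ 0) (k 0) +
      potOp (z - τ 1) (G μ 1) (k 1))) := by
    rw [← blockOp_apply (fun μ => z - τ μ)]
    rfl
  rw [e]
  filter_upwards [Lp.coeFn_sub (z • S k μ) (k μ - (potOp (z - τ 0) (G μ 0) (k 0) +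
      potOp (z - τ 1) (G μ 1) (k 1))), Lp.coeFn_smul z (S k μ),
    Lp.coeFn_sub (k μ) (potOp (z - τ 0) (G μ 0) (k 0) + potOp (z - τ 1) (G μ 1) (k 1)),
    Lp.coeFn_add (potOp (z - τ 0) (G μ 0) (k 0)) (potOp (z - τ 1) (G μ 1) (k 1)), hU μ,
    potOp_apply (z - τ 0) (G μ 0) (k 0), potOp_apply (z - τ 1) (G μ 1) (k 1),
    hq.ae (hG μ 0), hq.ae (hG μ 1)] with x h1 h2 h3 h4 h5 h6 h7 h8 h9
  rw [h1, Pi.sub_apply, h2, h3, Pi.smul_apply, Pi.sub_apply, h4, Pi.add_apply, h5, h6, h7, h8, h9,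
    smul_eq_mul]
  linear_combination (((z - τ μ) * green (z - τ μ) (k μ) x) - k μ x) * Complex.I_mul_I

theorem isDiracPair_unique {M : Matrix (Fin 2) (Fin 4) ℂ} {P Q : ℝ → ℂ} {u w w' : H}
    (h : IsDiracPair M P Q u w) (h' : IsDiracPair M P Q u w') : w = w' := by
  have h1 : (u, w) - (u, w') ∈ diracGraph M P Q := Submodule.sub_mem _ h h'
  exact sub_eq_zero.1 (diracGraph_isGraph M P Q _ h1 (sub_self u))

/-- If `1 - V R₀` is invertible then the spectral parameter is not in the spectrum. -/
theorem IsFreeData.notMem_spectrum {M : Matrix (Fin 2) (Fin 4) ℂ} {τ : Fin 2 → ℂ}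
    {W : Matrix (Fin 2) (Fin 2) ℂ} (h : IsFreeData M τ W) (hM : (minor M 0 3).det ≠ 0)
    {P Q : ℝ → ℂ} {z : ℂ} (hz : ∀ μ, Complex.exp (Complex.I * (z - τ μ) * Real.pi) ≠ 1)
    {G : Fin 2 → Fin 2 → L2}
    (hG : ∀ μ ν, ∀ᵐ x ∂intervalMeasure, G μ ν x = transPot τ W P Q μ ν x)
    (hunit : IsUnit (1 - blockOp (fun μ => z - τ μ) G)) :
    z ∉ unboundedSpectrum (diracOperator M P Q) := by
  obtain ⟨e, he⟩ := basisMap_isInvertible τ h.det_ne_zero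
  obtain ⟨s, hs⟩ := hunit
  have hA : ∀ F, e F = basisMap τ W F := fun F => congrArg (fun B : H →L[ℂ] H => B F) he
  set T := blockOp (fun μ => z - τ μ) G
  set S := diagRes (fun μ => z - τ μ)
  have hpair : ∀ k : H, IsDiracPair M P Q (e (S k)) (e (z • S k - (k - T k))) := fun k => by
    rw [hA, hA]
    exact h.isDiracPair_diagRes hM hz hG k
  have hs1 : ∀ F : H, (↑s⁻¹ : H →L[ℂ] H) F - T ((↑s⁻¹ : H →L[ℂ] H) F) = F := fun F => by
    have h1 := congrArg (fun B : H →L[ℂ] H => B F) s.mul_inv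
    rw [hs] at h1
    simpa using h1
  have hs2 : ∀ F : H, (↑s⁻¹ : H →L[ℂ] H) (F - T F) = F := fun F => by
    have h1 := congrArg (fun B : H →L[ℂ] H => B F) s.inv_mul
    rw [hs] at h1
    simpa using h1
  rw [unboundedSpectrum, mem_ofPred_eq, not_not]
  refine ⟨e.toContinuousLinearMap ∘L S ∘L (↑s⁻¹ : H →L[ℂ] H) ∘L e.symm.toContinuousLinearMap,
    fun f => ?_, fun u => ?_⟩
  · have h1 := hpair ((↑s⁻¹ : H →L[ℂ] H) (e.symm f))
    rw [hs1, map_sub, e.apply_symm_apply, map_smul, ← mem_graph_diracOperator,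
      LinearPMap.mem_graph_iff] at h1
    obtain ⟨y, hy1, hy2⟩ := h1
    have hy1' : (y : H) = (e.toContinuousLinearMap ∘L S ∘L (↑s⁻¹ : H →L[ℂ] H) ∘L
      e.symm.toContinuousLinearMap) f := hy1
    refine ⟨hy1' ▸ y.2, ?_⟩
    have hy3 : (⟨_, hy1' ▸ y.2⟩ : (diracOperator M P Q).domain) = y := Subtype.ext hy1'.symm
    rw [hy3, hy2]
    simp
  · have hu := (mem_graph_diracOperator M P Q _ _).1 ((diracOperator M P Q).mem_graph u)
    obtain ⟨F, dF, U, hF, hper, hU, hUu⟩ := h.exists_periodic_of_isDiracPair hM hu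
    have hk : ∀ ν, MemLp (fun x => Complex.I * dF ν x + (z - τ ν) * F ν x) 2 intervalMeasure :=
      fun ν => ((hF ν).memLp.const_mul _).add ((hF ν).memLp_self.const_mul _)
    let k : H := WithLp.toLp 2 fun ν => (hk ν).toLp _
    have hSk : S k = U := by
      ext ν : 1
      refine Lp.ext ?_
      have e1 : S k ν = resOp (z - τ ν) (k ν) := diagRes_apply _ _ _
      rw [e1]
      filter_upwards [resOp_apply (z - τ ν) (k ν), hU ν,
        ae_intervalMeasure_of_forall_mem fun x hx => green_congr_ae (l := z - τ ν)
          (f := k ν) (hk ν).coeFn_toLp hx,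
        ae_intervalMeasure_of_forall_mem fun x hx => (hF ν).green_eq (hz ν) (hper ν) hx]
        with x h1 h2 h3 h4
      rw [h1, h2, h3, h4]
    have h1 := hpair k
    rw [hSk, hA U, hUu] at h1
    have h2 := isDiracPair_unique hu h1
    have h3 : z • (u : H) - diracOperator M P Q u = e (k - T k) := by
      rw [h2, map_sub e (z • U), map_smul, hA U, hUu]
      abel
    rw [h3]
    simp only [ContinuousLinearMap.comp_apply, ContinuousLinearEquiv.coe_coe, e.symm_apply_apply,
      hs2, hSk, hA U, hUu]

/-! ### The matrix elements of the potential -/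

theorem wCoeff_eq_fourier (τ : Fin 2 → ℂ) (W : Matrix (Fin 2) (Fin 2) ℂ) {P Q : ℝ → ℂ}
    (hP : MemLp P 2 intervalMeasure) (hQ : MemLp Q 2 intervalMeasure) (μ ν : Fin 2) (n : ℤ) :
    wCoeff τ W P Q μ ν (2 * n) =
      ∫ x, Complex.exp (Complex.I * (2 * n) * x) * transPot τ W P Q μ ν x ∂intervalMeasure := by
  set E : ℂ := Complex.exp (Complex.I * (-τ μ) * Real.pi) with hE
  have hpi : Real.pi ∈ Icc 0 Real.pi := ⟨Real.pi_pos.le, le_rfl⟩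
  have h1 : MemLp (fun x : ℝ => Complex.exp (Complex.I * (2 * n + (τ ν + τ μ)) * x) *
      (E * (W⁻¹ μ 0 * W 1 ν) * P x)) 2 intervalMeasure := MemLp.exp_mul (hP.const_mul _) _
  have h2 : MemLp (fun x : ℝ => Complex.exp (Complex.I * (2 * n + (τ ν + τ μ)) * x) *
      (E * (W⁻¹ μ 1 * W 0 ν) * Q (Real.pi - x))) 2 intervalMeasure :=
    MemLp.exp_mul ((MemLp.comp_pi_sub hQ).const_mul _) _
  have h2' : MemLp (fun x : ℝ => Complex.exp (Complex.I * (2 * n + (τ ν + τ μ)) *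
      (Real.pi - x : ℝ)) * (E * (W⁻¹ μ 1 * W 0 ν) * Q x)) 2 intervalMeasure := by
    simpa only [sub_sub_cancel] using MemLp.comp_pi_sub h2
  have e1 : ∀ x : ℝ, P x * phi τ W ν 0 1 x * starRingEnd ℂ (phiDual τ W μ (2 * n) 0 x) =
      Complex.exp (Complex.I * (2 * n + (τ ν + τ μ)) * x) *
        (E * (W⁻¹ μ 0 * W 1 ν) * P x) := fun x => by
    have : Complex.exp (Complex.I * τ ν * x) *
        starRingEnd ℂ (Complex.exp (Complex.I * starRingEnd ℂ (τ μ) * (Real.pi - x))) *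
        starRingEnd ℂ (Complex.exp (-Complex.I * (2 * n : ℤ) * x)) =
        Complex.exp (Complex.I * (2 * n + (τ ν + τ μ)) * x) * E := by
      simp only [hE, ← Complex.exp_conj, ← Complex.exp_add]
      congr 1
      simp [map_ofNat (starRingEnd ℂ) 2]
      ring
    simp only [phi, phiDual, Matrix.cons_val_zero, Matrix.cons_val_one, map_mul,
      Int.cast_zero, mul_zero, zero_mul, Complex.exp_zero, mul_one, Complex.conj_conj]
    linear_combination (P x * W 1 ν * W⁻¹ μ 0) * this
  have e2 : ∀ x : ℝ, Q x * phi τ W ν 0 0 x * starRingEnd ℂ (phiDual τ W μ (2 * n) 1 x) =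
      Complex.exp (Complex.I * (2 * n + (τ ν + τ μ)) * (Real.pi - x : ℝ)) *
        (E * (W⁻¹ μ 1 * W 0 ν) * Q x) := fun x => by
    have : Complex.exp (Complex.I * τ ν * (Real.pi - x)) *
        starRingEnd ℂ (Complex.exp (Complex.I * starRingEnd ℂ (τ μ) * x)) *
        starRingEnd ℂ (Complex.exp (Complex.I * (2 * n : ℤ) * x)) =
        Complex.exp (Complex.I * (2 * n + (τ ν + τ μ)) * (Real.pi - x : ℝ)) * E := by
      rw [← mul_one (_ * starRingEnd ℂ _ * starRingEnd ℂ _), ← exp_two_int_pi n]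
      simp only [hE, ← Complex.exp_conj, ← Complex.exp_add]
      congr 1
      simp [map_ofNat (starRingEnd ℂ) 2]
      ring
    simp only [phi, phiDual, Matrix.cons_val_zero, Matrix.cons_val_one, map_mul,
      Int.cast_zero, mul_zero, zero_mul, Complex.exp_zero, mul_one, Complex.conj_conj]
    linear_combination (Q x * W 0 ν * W⁻¹ μ 1) * this
  have e3 : ∀ x : ℝ, Complex.exp (Complex.I * (2 * n) * x) * transPot τ W P Q μ ν x =
      Complex.exp (Complex.I * (2 * n + (τ ν + τ μ)) * x) * (E * (W⁻¹ μ 0 * W 1 ν) * P x) +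
      Complex.exp (Complex.I * (2 * n + (τ ν + τ μ)) * x) *
        (E * (W⁻¹ μ 1 * W 0 ν) * Q (Real.pi - x)) := fun x => by
    have : Complex.exp (Complex.I * (2 * n) * x) * Complex.exp (Complex.I * (τ ν + τ μ) * x) =
        Complex.exp (Complex.I * (2 * n + (τ ν + τ μ)) * x) := by
      rw [← Complex.exp_add]
      ring_nf
    rw [transPot, ← this]
    ring
  simp only [wCoeff, matrixElement, e1, e2, e3, integral_intervalMeasure]
  congr 1
  rw [intervalIntegral.integral_add (MemLp.intervalIntegrable_of_intervalMeasure h1 hpi)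
      (MemLp.intervalIntegrable_of_intervalMeasure h2' hpi),
    intervalIntegral.integral_add (MemLp.intervalIntegrable_of_intervalMeasure h1 hpi)
      (MemLp.intervalIntegrable_of_intervalMeasure h2 hpi)]
  congr 1
  have := intervalIntegral.integral_comp_sub_left (fun x : ℝ => Complex.exp (Complex.I *
    (2 * n + (τ ν + τ μ)) * x) * (E * (W⁻¹ μ 1 * W 0 ν) * Q (Real.pi - x)))
    (a := 0) (b := Real.pi) Real.pi
  simpa only [sub_sub_cancel, sub_zero, sub_self] using this

/-- The entries of the transformed potential, as elements of `L²`. -/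
def transPotL2 (τ : Fin 2 → ℂ) (W : Matrix (Fin 2) (Fin 2) ℂ) {P Q : ℝ → ℂ}
    (hP : MemLp P 2 intervalMeasure) (hQ : MemLp Q 2 intervalMeasure) (μ ν : Fin 2) : L2 :=
  (memLp_transPot τ W hP hQ μ ν).toLp _

theorem transPotL2_apply (τ : Fin 2 → ℂ) (W : Matrix (Fin 2) (Fin 2) ℂ) {P Q : ℝ → ℂ}
    (hP : MemLp P 2 intervalMeasure) (hQ : MemLp Q 2 intervalMeasure) (μ ν : Fin 2) :
    ∀ᵐ x ∂intervalMeasure, transPotL2 τ W hP hQ μ ν x = transPot τ W P Q μ ν x :=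
  (memLp_transPot τ W hP hQ μ ν).coeFn_toLp

theorem hasSum_sq_norm_wCoeff (τ : Fin 2 → ℂ) (W : Matrix (Fin 2) (Fin 2) ℂ) {P Q : ℝ → ℂ}
    (hP : MemLp P 2 intervalMeasure) (hQ : MemLp Q 2 intervalMeasure) (μ ν : Fin 2) :
    HasSum (fun n : ℤ => ‖wCoeff τ W P Q μ ν (2 * n)‖ ^ 2) (‖transPotL2 τ W hP hQ μ ν‖ ^ 2) := by
  convert hasSum_sq_norm_fourier (transPotL2 τ W hP hQ μ ν) using 4 with n
  rw [wCoeff_eq_fourier τ W hP hQ]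
  refine integral_congr_ae ?_
  filter_upwards [transPotL2_apply τ W hP hQ μ ν] with x hx
  rw [hx]

theorem norm_wCoeff_le_rCoeff (τ : Fin 2 → ℂ) (W : Matrix (Fin 2) (Fin 2) ℂ) (P Q : ℝ → ℂ)
    (μ ν : Fin 2) (m : ℤ) : ‖wCoeff τ W P Q μ ν m‖ ≤ rCoeff τ W P Q m := by
  unfold rCoeff
  fin_cases μ <;> fin_cases ν <;> simp

theorem norm_transPotL2_sq_le (τ : Fin 2 → ℂ) (W : Matrix (Fin 2) (Fin 2) ℂ) {P Q : ℝ → ℂ}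
    (hP : MemLp P 2 intervalMeasure) (hQ : MemLp Q 2 intervalMeasure) (μ ν : Fin 2) :
    ‖transPotL2 τ W hP hQ μ ν‖ ^ 2 ≤ rNormSq τ W P Q := by
  have h := hasSum_sq_norm_wCoeff τ W hP hQ
  have hs := (((h 0 0).summable.add (h 0 1).summable).add (h 1 0).summable).add (h 1 1).summable
  have hr : Summable fun n : ℤ => rCoeff τ W P Q (2 * n) ^ 2 := by
    refine Summable.of_nonneg_of_le (fun n => sq_nonneg _) (fun n => ?_) hs
    have a := sq_nonneg ‖wCoeff τ W P Q 0 0 (2 * n)‖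
    have b := sq_nonneg ‖wCoeff τ W P Q 0 1 (2 * n)‖
    have c := sq_nonneg ‖wCoeff τ W P Q 1 0 (2 * n)‖
    have d := sq_nonneg ‖wCoeff τ W P Q 1 1 (2 * n)‖
    unfold rCoeff
    rcases max_choice (max ‖wCoeff τ W P Q 0 0 (2 * n)‖ ‖wCoeff τ W P Q 0 1 (2 * n)‖)
      (max ‖wCoeff τ W P Q 1 0 (2 * n)‖ ‖wCoeff τ W P Q 1 1 (2 * n)‖) with e | e <;> rw [e]
    · rcases max_choice ‖wCoeff τ W P Q 0 0 (2 * n)‖ ‖wCoeff τ W P Q 0 1 (2 * n)‖ with e | e <;>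
        rw [e] <;> linarith
    · rcases max_choice ‖wCoeff τ W P Q 1 0 (2 * n)‖ ‖wCoeff τ W P Q 1 1 (2 * n)‖ with e | e <;>
        rw [e] <;> linarith
  rw [← (h μ ν).tsum_eq, rNormSq]
  exact (h μ ν).summable.tsum_le_tsum (fun n => pow_le_pow_left₀ (norm_nonneg _)
    (norm_wCoeff_le_rCoeff τ W P Q μ ν (2 * n)) 2) hr

/-! ### Norms of the block operators -/

theorem norm_H_le {X Y : H} {c : ℝ} (hc : 0 ≤ c) (h : ∀ μ, ‖Y μ‖ ≤ c * (‖X 0‖ + ‖X 1‖)) :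
    ‖Y‖ ≤ 2 * c * ‖X‖ := by
  have hX := PiLp.norm_sq_eq_of_L2 (fun _ : Fin 2 => L2) X
  have hY := PiLp.norm_sq_eq_of_L2 (fun _ : Fin 2 => L2) Y
  rw [Fin.sum_univ_two] at hX hY
  have h0 := pow_le_pow_left₀ (norm_nonneg _) (h 0) 2
  have h1 := pow_le_pow_left₀ (norm_nonneg _) (h 1) 2
  refine le_of_sq_le_sq ?_ (by positivity)
  have h2 : (c * (‖X 0‖ + ‖X 1‖)) ^ 2 ≤ 2 * c ^ 2 * ‖X‖ ^ 2 := by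
    rw [hX]
    nlinarith [mul_nonneg (sq_nonneg c) (sq_nonneg (‖X 0‖ - ‖X 1‖))]
  calc ‖Y‖ ^ 2 ≤ 2 * (c * (‖X 0‖ + ‖X 1‖)) ^ 2 := by rw [hY]; linarith
    _ ≤ (2 * c * ‖X‖) ^ 2 := by linarith

theorem norm_blockOp_le {l : Fin 2 → ℂ} {G : Fin 2 → Fin 2 → L2} {g b : ℝ} (hg : 0 ≤ g)
    (hb : 0 ≤ b) (hG : ∀ μ ν, ‖G μ ν‖ ≤ g) (hl : ∀ ν, greenBound (l ν) ≤ b) :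
    ‖blockOp l G‖ ≤ 2 * (g * b) := by
  refine ContinuousLinearMap.opNorm_le_bound _ (by positivity) fun F => ?_
  refine norm_H_le (by positivity) fun μ => ?_
  rw [blockOp_apply, mul_add]
  refine (norm_add_le _ _).trans (add_le_add ?_ ?_)
  all_goals
    refine (norm_potOp_apply_le _ _ _).trans ?_
    rw [mul_assoc]
    exact mul_le_mul (hG _ _) (mul_le_mul_of_nonneg_right (hl _) (norm_nonneg _))
      (mul_nonneg (greenBound_nonneg _) (norm_nonneg _)) hg

theorem blockOp_smul (l : Fin 2 → ℂ) (c : ℂ) (G : Fin 2 → Fin 2 → L2) :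
    blockOp l (fun μ ν => c • G μ ν) = c • blockOp l G := by
  ext F μ : 2
  have e : (c • blockOp l G) F μ = c • blockOp l G F μ := rfl
  rw [e, blockOp_apply, blockOp_apply, potOp_smul, potOp_smul, smul_add]

/-- The square of the block operator is small if the sums of the spectral parameters are large. -/
theorem norm_blockOp_sq_le {l : Fin 2 → ℂ} {G : Fin 2 → Fin 2 → L2} {g ε : ℝ} (hg : 0 ≤ g)
    (hε : 0 ≤ ε) (hG : ∀ μ ν, ‖G μ ν‖ ≤ g)
    (h : ∀ ν κ, ∀ a f : L2, ‖potOp (l ν) a (potOp (l κ) (G ν κ) f)‖ ≤ ε * ‖a‖ * ‖f‖) :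
    ‖blockOp l G * blockOp l G‖ ≤ 4 * (ε * g) := by
  refine ContinuousLinearMap.opNorm_le_bound _ (by positivity) fun F => ?_
  have h2 := norm_H_le (X := F) (Y := (blockOp l G * blockOp l G) F) (c := 2 * (ε * g))
    (by positivity) fun μ => ?_
  · linarith
  change ‖blockOp l G (blockOp l G F) μ‖ ≤ _
  rw [blockOp_apply, blockOp_apply, blockOp_apply, map_add, map_add]
  have key : ∀ ν κ, ‖potOp (l ν) (G μ ν) (potOp (l κ) (G ν κ) (F κ))‖ ≤ ε * g * ‖F κ‖ :=
    fun ν κ => (h ν κ _ _).trans (by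
      gcongr
      exact hG _ _)
  refine (norm_add_le _ _).trans ((add_le_add (norm_add_le _ _) (norm_add_le _ _)).trans ?_)
  linarith [key 0 0, key 0 1, key 1 0, key 1 1]

theorem isUnit_one_sub_of_norm_mul_self_lt_one {T : H →L[ℂ] H} (h : ‖T * T‖ < 1) :
    IsUnit (1 - T) := by
  have h1 := isUnit_one_sub_of_norm_lt_one h
  have h2 : 1 - T * T = (1 - T) * (1 + T) := by
    rw [sub_mul, one_mul, mul_add, mul_one]
    abel
  rw [h2] at h1
  have hc : Commute (1 - T) (1 + T) :=
    ((Commute.one_right _).add_right ((Commute.one_left T).sub_left (Commute.refl T)))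
  exact (hc.isUnit_mul_iff.1 h1).1

/-! ### Localization of the spectrum -/

theorem transPotL2_smul_apply (τ : Fin 2 → ℂ) (W : Matrix (Fin 2) (Fin 2) ℂ) {P Q : ℝ → ℂ}
    (hP : MemLp P 2 intervalMeasure) (hQ : MemLp Q 2 intervalMeasure) (ζ : ℂ) (μ ν : Fin 2) :
    ∀ᵐ x ∂intervalMeasure, (ζ • transPotL2 τ W hP hQ μ ν) x =
      transPot τ W (fun x => ζ * P x) (fun x => ζ * Q x) μ ν x := by
  filter_upwards [Lp.coeFn_smul ζ (transPotL2 τ W hP hQ μ ν), transPotL2_apply τ W hP hQ μ ν]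
    with x h1 h2
  rw [h1, Pi.smul_apply, h2, smul_eq_mul, transPot, transPot]
  ring

instance nontrivial_H : Nontrivial H := by
  refine ⟨⟨WithLp.toLp 2 fun _ => Lp.const 2 intervalMeasure (1 : ℂ), 0, fun h => ?_⟩⟩
  have h1 : Lp.const 2 intervalMeasure (1 : ℂ) = 0 := congrArg (fun F : H => F 0) h
  have h2 : ‖Lp.const 2 intervalMeasure (1 : ℂ)‖ = _ := Lp.norm_const (hp_zero := two_ne_zero) ..
  rw [h1] at h2
  simp at h2

theorem one_le_norm_basisMap_mul (τ : Fin 2 → ℂ) {W : Matrix (Fin 2) (Fin 2) ℂ} (hW : W.det ≠ 0) :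
    1 ≤ ‖basisMap τ W‖ * ‖(basisMap τ W).inverse‖ := by
  obtain ⟨e, he⟩ := basisMap_isInvertible τ hW
  rw [← he, ContinuousLinearMap.inverse_equiv]
  exact e.one_le_norm_mul_norm_symm

/-- There is no spectrum above the height `T`, since `‖V R₀‖ < 1` there. -/
theorem IsFreeData.notMem_spectrum_of_height_le {M : Matrix (Fin 2) (Fin 4) ℂ} {τ : Fin 2 → ℂ}
    {W : Matrix (Fin 2) (Fin 2) ℂ} (h : IsFreeData M τ W) (hM : (minor M 0 3).det ≠ 0)
    {P Q : ℝ → ℂ} (hP : MemLp P 2 intervalMeasure) (hQ : MemLp Q 2 intervalMeasure) {ζ : ℂ}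
    (hζ : ‖ζ‖ ≤ 1) {z : ℂ} (hz : height τ W P Q ≤ |z.im|) :
    z ∉ unboundedSpectrum (diracOperator M (fun x => ζ * P x) (fun x => ζ * Q x)) := by
  have hκ := one_le_norm_basisMap_mul τ h.det_ne_zero
  set R := rNormSq τ W P Q with hR
  have hR0 : 0 ≤ R := (sq_nonneg _).trans (norm_transPotL2_sq_le τ W hP hQ 0 0)
  have h1 : 1 ≤ |z.im| := (le_max_left _ _).trans hz
  have h2 := (le_max_right _ _).trans hz
  have h3 : ∀ ν, |(τ ν).im| ≤ |z.im| / 2 := by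
    have a := (le_max_left _ _).trans ((le_max_left _ _).trans ((le_div_iff₀' two_pos).2 h2))
    have b := (le_max_right _ _).trans ((le_max_left _ _).trans ((le_div_iff₀' two_pos).2 h2))
    exact Fin.forall_fin_two.2 ⟨a, b⟩
  have h4 : 384 * R ≤ |z.im| / 2 := by
    have a := (le_max_right _ _).trans ((le_div_iff₀' two_pos).2 h2)
    refine le_trans ?_ a
    rw [mul_assoc 384, ← hR]
    nlinarith
  -- subtracting `τ ν` costs at most half of the imaginary part
  have h5 : ∀ ν, |z.im| / 2 ≤ |(z - τ ν).im| := fun ν => by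
    have := abs_sub_abs_le_abs_sub z.im (τ ν).im
    rw [Complex.sub_im]
    linarith [h3 ν]
  have h6 : ∀ ν, R * greenBound (z - τ ν) ^ 2 ≤ 20 / 384 := fun ν => by
    have a := greenBound_le_of_im (l := z - τ ν) (by linarith [h5 ν])
    have b : 384 * R * greenBound (z - τ ν) ^ 2 ≤
        |(z - τ ν).im| * greenBound (z - τ ν) ^ 2 :=
      mul_le_mul_of_nonneg_right (h4.trans (h5 ν)) (sq_nonneg _)
    linarith
  refine h.notMem_spectrum hM (fun ν hν => ?_) (transPotL2_smul_apply τ W hP hQ ζ)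
    (isUnit_one_sub_of_norm_lt_one ?_)
  · obtain ⟨n, hn⟩ := (exp_I_mul_pi_eq_one_iff _).1 hν
    have := h5 ν
    rw [hn] at this
    simp at this
    linarith
  · have hb0 : 0 ≤ max (greenBound (z - τ 0)) (greenBound (z - τ 1)) :=
      (greenBound_nonneg _).trans (le_max_left _ _)
    have hT := norm_blockOp_le (l := fun μ => z - τ μ) (Real.sqrt_nonneg R) hb0
      (G := fun μ ν => ζ • transPotL2 τ W hP hQ μ ν) (fun μ ν => by
        rw [norm_smul]
        refine (mul_le_of_le_one_left (norm_nonneg _) hζ).trans ?_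
        exact Real.le_sqrt_of_sq_le (norm_transPotL2_sq_le τ W hP hQ μ ν))
      (Fin.forall_fin_two.2 ⟨le_max_left _ _, le_max_right _ _⟩)
    have h7 : (√R * max (greenBound (z - τ 0)) (greenBound (z - τ 1))) ^ 2 ≤ 20 / 384 := by
      rw [mul_pow, Real.sq_sqrt hR0]
      rcases max_choice (greenBound (z - τ 0)) (greenBound (z - τ 1)) with e | e <;> rw [e]
      · exact h6 0
      · exact h6 1
    have h8 : √R * max (greenBound (z - τ 0)) (greenBound (z - τ 1)) < 1 / 2 := by
      refine lt_of_pow_lt_pow_left₀ 2 (by norm_num) (h7.trans_lt (by norm_num))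
    linarith

theorem IsFreeData.radius_pos {M : Matrix (Fin 2) (Fin 4) ℂ} {τ : Fin 2 → ℂ}
    {W : Matrix (Fin 2) (Fin 2) ℂ} (h : IsFreeData M τ W) : 0 < radius τ := by
  refine lt_min ?_ ?_
  · have := h.re_sub_le
    rw [Complex.sub_re]
    linarith
  · refine half_pos (norm_pos_iff.2 (sub_ne_zero.2 fun e => h.root_ne ?_))
    rw [e]

/-- Far from the imaginary axis, there is no spectrum outside of the discs about the eigenvalues of
the free operator, since `‖(V R₀)²‖ < 1` there. -/
theorem IsFreeData.exists_notMem_spectrum {M : Matrix (Fin 2) (Fin 4) ℂ} {τ : Fin 2 → ℂ}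
    {W : Matrix (Fin 2) (Fin 2) ℂ} (h : IsFreeData M τ W) (hM : (minor M 0 3).det ≠ 0)
    {P Q : ℝ → ℂ} (hP : MemLp P 2 intervalMeasure) (hQ : MemLp Q 2 intervalMeasure) :
    ∃ N : ℝ, ∀ ζ : ℂ, ‖ζ‖ ≤ 1 → ∀ z : ℂ, (∀ μ (n : ℤ), radius τ ≤ ‖z - τ μ - 2 * n‖) →
      N ≤ |z.re - ((τ 0 + τ 1) / 2).re| →
      z ∉ unboundedSpectrum (diracOperator M (fun x => ζ * P x) (fun x => ζ * Q x)) := by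
  obtain ⟨C, hC⟩ := exists_greenBound_le h.radius_pos
  set G := transPotL2 τ W hP hQ
  obtain ⟨g, hg⟩ : ∃ g : ℝ, ∀ μ ν, ‖G μ ν‖ ≤ g :=
    ⟨√(rNormSq τ W P Q), fun μ ν => Real.le_sqrt_of_sq_le (norm_transPotL2_sq_le τ W hP hQ μ ν)⟩
  have hg0 : 0 ≤ g := (norm_nonneg _).trans (hg 0 0)
  -- this `ε` makes the bound `4 ε g` of `norm_blockOp_sq_le` less than `1`
  have hε : 0 < 1 / (8 * (g + 1)) := by positivity
  choose N hN using fun ν κ => exists_norm_potOp_potOp_le C (G ν κ) hε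
  obtain ⟨B, hB⟩ : ∃ B : ℝ, ∀ ν κ, N ν κ ≤ B :=
    ⟨max (max (N 0 0) (N 0 1)) (max (N 1 0) (N 1 1)), Fin.forall_fin_two.2
      ⟨Fin.forall_fin_two.2 ⟨by simp, by simp⟩, Fin.forall_fin_two.2 ⟨by simp, by simp⟩⟩⟩
  refine ⟨(|B| + 1) / 2, fun ζ hζ z hz hre => ?_⟩
  have hl : ∀ ν, Complex.exp (Complex.I * (z - τ ν) * Real.pi) ≠ 1 ∧ greenBound (z - τ ν) ≤ C :=
    fun ν => hC _ (hz ν)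
  -- `Re ((z - τ κ) + (z - τ ν))` differs from `2 Re (z - (τ 0 + τ 1) / 2)` by at most `1`
  have hsum : ∀ ν κ, N ν κ ≤ ‖z - τ κ + (z - τ ν)‖ := fun ν κ => by
    refine (hB ν κ).trans ((le_abs_self B).trans ((?_ : _ ≤ _).trans (Complex.abs_re_le_norm _)))
    have h1 : |(τ κ).re + (τ ν).re - ((τ 0).re + (τ 1).re)| ≤ 1 := by
      have h2 := abs_le.1 h.re_sub_le
      rw [abs_le]
      fin_cases κ <;> fin_cases ν <;> constructor <;> simp <;> linarith [h2.1, h2.2]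
    have h3 : (z - τ κ + (z - τ ν)).re = 2 * (z.re - ((τ 0 + τ 1) / 2).re) -
        ((τ κ).re + (τ ν).re - ((τ 0).re + (τ 1).re)) := by
      simp
      ring
    rw [h3]
    have h4 := abs_sub_abs_le_abs_sub (2 * (z.re - ((τ 0 + τ 1) / 2).re))
      ((τ κ).re + (τ ν).re - ((τ 0).re + (τ 1).re))
    rw [abs_mul, abs_two] at h4
    linarith
  refine h.notMem_spectrum hM (fun ν => (hl ν).1) (transPotL2_smul_apply τ W hP hQ ζ)
    (isUnit_one_sub_of_norm_mul_self_lt_one ?_)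
  have hT := norm_blockOp_sq_le (l := fun μ => z - τ μ) hg0 hε.le hg fun ν κ =>
    hN ν κ _ _ (hl κ).1 (hl ν).1 (hl κ).2 (hl ν).2 (hsum ν κ)
  rw [blockOp_smul, smul_mul_smul_comm, norm_smul, norm_mul]
  have h1 : ‖ζ‖ * ‖ζ‖ ≤ 1 := mul_le_one₀ hζ (norm_nonneg _) hζ
  refine (mul_le_of_le_one_left (norm_nonneg _) h1).trans_lt (hT.trans_lt ?_)
  rw [one_div, inv_mul_eq_div, mul_div_assoc', div_lt_one (by positivity)]
  linarith

/-- The set of the admissible choices of the exponents is finite, because the real parts are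
bounded. -/
theorem finite_setOf_isFreeData {M : Matrix (Fin 2) (Fin 4) ℂ} (hM : (minor M 0 3).det ≠ 0) :
    {τ : Fin 2 → ℂ | ∃ W, IsFreeData M τ W}.Finite := by
  let p : Polynomial ℂ := Polynomial.C (minor M 0 3).det * Polynomial.X ^ 2 +
    Polynomial.C ((minor M 0 2).det + (minor M 1 3).det) * Polynomial.X +
    Polynomial.C (minor M 1 2).det
  have hp : p ≠ 0 := fun h0 => hM (by
    rw [← Polynomial.leadingCoeff_quadratic (b := (minor M 0 2).det + (minor M 1 3).det)
      (c := (minor M 1 2).det) hM]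
    exact (congrArg Polynomial.leadingCoeff h0).trans Polynomial.leadingCoeff_zero)
  have hfib : ∀ e : ℂ,
      {t : ℂ | Complex.exp (Complex.I * Real.pi * t) = e ∧ |t.re| ≤ 2}.Finite := by
    intro e
    rcases eq_empty_or_nonempty {t : ℂ | Complex.exp (Complex.I * Real.pi * t) = e ∧ |t.re| ≤ 2}
      with h0 | ⟨s, hs1, hs2⟩
    · rw [h0]
      exact finite_empty
    · refine ((Set.finite_Icc (-2 : ℤ) 2).image fun n : ℤ => s + 2 * (n : ℂ)).subset fun t ht => ?_
      have h1 : Complex.exp (Complex.I * (t - s) * Real.pi) = 1 := by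
        rw [show Complex.I * (t - s) * Real.pi = Complex.I * Real.pi * t - Complex.I * Real.pi * s
          by ring, Complex.exp_sub, ht.1, hs1, div_self]
        rw [← hs1]
        exact Complex.exp_ne_zero _
      obtain ⟨n, hn⟩ := (exp_I_mul_pi_eq_one_iff _).1 h1
      have hre := congrArg Complex.re hn
      simp at hre
      have a := abs_le.1 ht.2
      have b := abs_le.1 hs2
      refine ⟨n, ⟨?_, ?_⟩, by linear_combination -hn⟩
      · have : (-2 : ℝ) ≤ n := by linarith [a.1, b.2]
        exact_mod_cast this
      · have : (n : ℝ) ≤ 2 := by linarith [a.2, b.1]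
        exact_mod_cast this
  have hR := (Polynomial.finite_setOfPred_isRoot hp).biUnion fun e _ => hfib e
  refine (Set.Finite.pi' fun _ : Fin 2 => hR).subset ?_
  rintro τ ⟨W, h⟩ μ
  rw [mem_iUnion₂]
  refine ⟨Complex.exp (Complex.I * Real.pi * τ μ), ?_, rfl, ?_⟩
  · have := h.root μ
    simpa [p, Polynomial.IsRoot] using this
  · have a := abs_le.1 h.re_sub_le
    have b := abs_le.1 h.re_le
    rw [abs_le]
    fin_cases μ <;> constructor <;> simp <;> linarith [a.1, a.2, b.1, b.2]

/-- An even integer close to a given large real number. -/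
theorem exists_even_near {N : ℕ} (hN : Even N) {s : ℝ} (hs : N + 1 ≤ |s|) :
    ∃ k : ℤ, (N : ℤ) < |2 * k| ∧ |s - 2 * k| ≤ 1 := by
  obtain ⟨j, rfl⟩ := hN
  push_cast at hs
  rcases le_abs.1 hs with h | h
  · refine ⟨⌊(s + 1) / 2⌋, ?_, ?_⟩
    · have : (j : ℤ) + 1 ≤ ⌊(s + 1) / 2⌋ := Int.le_floor.2 (by push_cast; linarith)
      push_cast
      rw [abs_of_nonneg (by omega)]
      omega
    · have a := Int.floor_le ((s + 1) / 2)
      have b := Int.lt_floor_add_one ((s + 1) / 2)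
      rw [abs_le]
      constructor <;> linarith
  · refine ⟨⌈(s - 1) / 2⌉, ?_, ?_⟩
    · have : ⌈(s - 1) / 2⌉ ≤ -(j : ℤ) - 1 := Int.ceil_le.2 (by push_cast; linarith)
      push_cast
      rw [abs_of_nonpos (by omega)]
      omega
    · have a := Int.le_ceil ((s - 1) / 2)
      have b := Int.ceil_lt_add_one ((s - 1) / 2)
      rw [abs_le]
      constructor <;> linarith

/-- A point outside of the discs `D^μ_m` for one even `m` close to its real part is outside of these
discs for all even `m`. -/
theorem radius_le_of_notMem_disc {τ : Fin 2 → ℂ} {z : ℂ} {k : ℤ}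
    (hk : |z.re - ((τ 0 + τ 1) / 2).re - 2 * k| ≤ 1)
    (hz : ∀ μ, z ∉ disc τ μ (2 * k)) (μ : Fin 2) (n : ℤ) : radius τ ≤ ‖z - τ μ - 2 * n‖ := by
  rcases eq_or_ne n k with rfl | hne
  · have h1 := hz μ
    rw [disc, Metric.mem_ball, not_lt, dist_eq_norm] at h1
    refine h1.trans (le_of_eq ?_)
    push_cast
    congr 1
    ring
  · refine (min_le_left _ _).trans (le_trans ?_ (Complex.abs_re_le_norm _))
    have h1 : (1 : ℝ) ≤ |(n : ℝ) - k| := by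
      have : (1 : ℤ) ≤ |n - k| := Int.one_le_abs (sub_ne_zero.2 hne)
      exact_mod_cast this
    have h2 : |(τ μ).re - ((τ 0 + τ 1) / 2).re| = |(τ 0 - τ 1).re| / 2 := by
      rw [show |(τ 0 - τ 1).re| / 2 = |(τ 0 - τ 1).re / 2| by rw [abs_div, abs_two]]
      fin_cases μ
      · congr 1
        simp
        ring
      · rw [← abs_neg]
        congr 1
        simp
        ring
    have h3 : 2 * ((n : ℝ) - k) = (z.re - ((τ 0 + τ 1) / 2).re - 2 * k) -
        ((τ μ).re - ((τ 0 + τ 1) / 2).re) - (z - τ μ - 2 * n).re := by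
      simp
      ring
    have h4 : |2 * ((n : ℝ) - k)| = 2 * |(n : ℝ) - k| := by rw [abs_mul, abs_two]
    rw [h3] at h4
    have h5 := abs_sub ((z.re - ((τ 0 + τ 1) / 2).re - 2 * k) -
        ((τ μ).re - ((τ 0 + τ 1) / 2).re)) (z - τ μ - 2 * n).re
    have h6 := abs_sub (z.re - ((τ 0 + τ 1) / 2).re - 2 * k) ((τ μ).re - ((τ 0 + τ 1) / 2).re)
    linarith

end DiracBVP

end

theorem theorem12 (M : Matrix (Fin 2) (Fin 4) ℂ) (hM : DiracBVP.StrictlyRegular M)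
    (P Q : ℝ → ℂ) (hP : MeasureTheory.MemLp P 2 DiracBVP.intervalMeasure)
    (hQ : MeasureTheory.MemLp Q 2 DiracBVP.intervalMeasure) :
    ∃ N : ℕ, 0 < N ∧ Even N ∧
      ∀ (τ : Fin 2 → ℂ) (W : Matrix (Fin 2) (Fin 2) ℂ), DiracBVP.IsFreeData M τ W →
        ∀ ζ : ℂ, ‖ζ‖ ≤ 1 →
          DiracBVP.unboundedSpectrum
              (DiracBVP.diracOperator M (fun x => ζ * P x) (fun x => ζ * Q x)) ⊆
            DiracBVP.rectangle τ N (DiracBVP.height τ W P Q) ∪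
              ⋃ m ∈ {m : ℤ | Even m ∧ (N : ℤ) < |m|},
                (DiracBVP.disc τ 0 m ∪ DiracBVP.disc τ 1 m) := by
  have hfin := DiracBVP.finite_setOf_isFreeData hM.det14
  have hN : ∀ τ : Fin 2 → ℂ, ∃ N : ℝ, (∃ W, DiracBVP.IsFreeData M τ W) →
      ∀ ζ : ℂ, ‖ζ‖ ≤ 1 → ∀ z : ℂ, (∀ μ (n : ℤ), DiracBVP.radius τ ≤ ‖z - τ μ - 2 * n‖) →
      N ≤ |z.re - ((τ 0 + τ 1) / 2).re| → z ∉ DiracBVP.unboundedSpectrum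
        (DiracBVP.diracOperator M (fun x => ζ * P x) (fun x => ζ * Q x)) := fun τ => by
    by_cases h : ∃ W, DiracBVP.IsFreeData M τ W
    · obtain ⟨W, hW⟩ := h
      obtain ⟨N, hN⟩ := hW.exists_notMem_spectrum hM.det14 hP hQ
      exact ⟨N, fun _ => hN⟩
    · exact ⟨0, fun h' => absurd h' h⟩
  choose N hN using hN
  obtain ⟨B, hB⟩ := (hfin.image N).bddAbove
  obtain ⟨n, hn⟩ := exists_nat_ge B
  refine ⟨2 * (n + 1), by omega, even_two_mul _, fun τ W h ζ hζ z hz => ?_⟩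
  by_contra hcon
  rw [Set.mem_union, not_or] at hcon
  obtain ⟨hrect, hdisc⟩ := hcon
  by_cases him : DiracBVP.height τ W P Q ≤ |z.im|
  · exact h.notMem_spectrum_of_height_le hM.det14 hP hQ hζ him hz
  have hre : ((2 * (n + 1) : ℕ) : ℝ) + 1 ≤ |z.re - ((τ 0 + τ 1) / 2).re| := by
    by_contra hlt
    exact hrect ⟨not_le.1 hlt, not_le.1 him⟩
  obtain ⟨k, hk1, hk2⟩ := DiracBVP.exists_even_near (even_two_mul (n + 1)) hre
  have hk3 : ∀ μ, z ∉ DiracBVP.disc τ μ (2 * k) := by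
    intro μ hμ
    refine hdisc (Set.mem_iUnion₂.2 ⟨2 * k, ⟨even_two_mul k, hk1⟩, ?_⟩)
    fin_cases μ
    · exact Or.inl hμ
    · exact Or.inr hμ
  refine hN τ ⟨W, h⟩ ζ hζ z (DiracBVP.radius_le_of_notMem_disc hk2 hk3) ?_ hz
  have h1 : N τ ≤ B := hB (Set.mem_image_of_mem N ⟨W, h⟩)
  push_cast at hre
  linarith
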